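/- Let $\Gamma=(V,E)$ be a finite simplicial graph, $V^{\pm}$ the set of vertices and their formal inverses, $lk(v)$ and $st(v)=lk(v)\cup\{v\}$ the link and star of $v$ in $\Gamma$; write $v\le w$ if $lk(v)\subseteq st(w)$ and $v\sim w$ if $v\le w\le v$ (signs are ignored when these notions are applied to elements of $V^\pm$). *Whitehead partitions.* A $\Gamma$-Whitehead pair $(P,m)$ consists of a set $P\subseteq V^{\pm}$ with at least two elements and some $m\in P$ with $m^{-1}\notin P$ such that no element of $P$ is adjacent to $m$; $v\in P$ and $v^{-1}\notin P$ imply $v\le m$; and if $v^{\pm}\in P$ then $w^{\pm}\in P$ for all $w$ in the component of $v$ in $\Gamma\setminus st(m)$. Put $lk(P)=lk(m)^{\pm}$ and $P^*=V^{\pm}\setminus(P\cup lk(P))$. If also $(P^*,m^{-1})$ is a $\Gamma$-Whitehead pair (so that both sides have at least two elements), $\mathbf P=\{P,lk(P),P^*\}$ is a $\Gamma$-Whitehead partition with sides $P,P^*$. An element $v$ is a single of a side if it lies in that side and $v^{-1}$ does not; $\max(P)$ is the set of singles $v$ of $P$ with $v\sim m$. Partitions $\mathbf P,\mathbf Q$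 commute if the elements of $\max(P)$ are adjacent to those of $\max(Q)$; they are compatible if they commute or one of $P\cap Q$, $P^*\cap Q$, $P\cap Q^*$, $P^*\cap Q^*$ is empty. *Blow-ups.* Let $\mathbf\Pi=\{\mathbf P_1,\dots,\mathbf P_k\}$, $k\ge 0$, be a collection of distinct, pairwise compatible $\Gamma$-Whitehead partitions. The blow-up $\mathbb S_{\mathbf\Pi}$ is the following cube complex. Its vertices are the regions: choices $R=(P_i^\times)_i$ of sides $P_i^\times\in\{P_i,P_i^*\}$ such that for all $i,j$ either $\mathbf P_i,\mathbf P_j$ commute or $P_i^\times\cap P_j^\times\ne\emptyset$. Two regions that differ exactly in the side of $\mathbf P_i$ are joined by an edge labelled $\mathbf P_i$. If $v\in I(R)=\bigcap_i (P_i^\times\cup lk(P_i))$, an edge labelled $v$ leads from $R$ to the region obtained by switching exactly those sides $P_i^\times$ in which $v$ is a single; its inverse is the edge labelled $v^{-1}$ (it is a loop if $v^\pm\in I(R)$). Two labels commute if they are two adjacent generators, or a generator in $lk(P_i)$ and $\mathbf P_i$, or two distinct commuting partitions. An $n$-cube is glued in wherever the 1-skeleton of an $n$-cube occurs whose parallel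 edges carry the same oriented label and whose $n$ labels pairwise commute. For $k=0$ this is the Salvetti complex. *Theorem.* The cube complex $X=\mathbb S_{\mathbf\Pi}$ is compact and special (non-positively curved, without one-sided, self-intersecting, directly self-osculating or inter-osculating hyperplanes), and it satisfies: 1. If $K_1\neq K_2$ are hyperplanes of $X$ with $K_1\cap K_2\neq\emptyset$, there is $\alpha\in H_1(X;\mathbb Z)$ with $\alpha.K_1\ne\alpha.K_2$ (algebraic intersection numbers), whatever transverse orientations of $K_1$ and $K_2$ are used. 2. If $K_1,K_2$ are hyperplanes with $K_1\cap K_2=\emptyset$ and $K_1\cup K_2$ separates $X$, then every component of $X\setminus (K_1\cup K_2)$ contains a hyperplane $L$ which does not meet $K_1$ or $K_2$ and is non-separating, both in $X$ and in that component. 3. If an automorphism $f$ of the cube complex $X$ maps every hyperplane to itself, preserving its transverse orientation, then $f$ is the identity. Consequently, every automorphism $f\neq \mathrm{id}$ of the cube complex $X$ acts nontrivially on $H_1(X;\mathbb Z)$. -/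

import Mathlib

universe u

/-! ## Cube complexes

A cube complex is described by its parametrized cubes: for every `n`, the set of characteristic
maps `[0,1]^n → X` of its `n`-cubes, in all their `2^n * n!` parametrizations, together with the
restriction to faces. -/

/-- An isometric embedding of `[0,1]^m` onto an `m`-dimensional face of `[0,1]^n`.  It is determined
by the image `corner` of the vertex `(0,…,0)` and by the coordinate direction `dir j` of the target
along which the `j`-th coordinate of the source moves (away from `corner`). -/
@[ext]
structure CubeMap (m n : ℕ) where
  corner : Fin n → Bool
  dir : Fin m ↪ Fin n

namespace CubeMap

/-- The effect on vertices: coordinate `dir j` is flipped exactly when `x j = 1`. -/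
def onVertex {m n : ℕ} (g : CubeMap m n) (x : Fin m → Bool) : Fin n → Bool :=
  fun i => xor (g.corner i) (decide (∃ j, g.dir j = i ∧ x j = true))

/-- The identity of `[0,1]^n`. -/
def id (n : ℕ) : CubeMap n n := ⟨fun _ => false, Function.Embedding.refl _⟩

/-- `g.comp h` is `h` followed by `g`. -/
def comp {k m n : ℕ} (g : CubeMap m n) (h : CubeMap k m) : CubeMap k n :=
  ⟨g.onVertex h.corner, h.dir.trans g.dir⟩

/-- The inclusion of the vertex `x`. -/
def vertex {n : ℕ} (x : Fin n → Bool) : CubeMap 0 n := ⟨x, Function.Embedding.ofIsEmpty⟩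

/-- The inclusion of the edge that starts at the vertex `x` and moves in direction `i`. -/
def edge {n : ℕ} (i : Fin n) (x : Fin n → Bool) : CubeMap 1 n :=
  ⟨x, ⟨fun _ => i, fun _ _ _ => Subsingleton.elim _ _⟩⟩

theorem onVertex_id {n : ℕ} (x : Fin n → Bool) : (CubeMap.id n).onVertex x = x := by
  funext i
  simp [onVertex, CubeMap.id]

theorem onVertex_dir {m n : ℕ} (g : CubeMap m n) (x : Fin m → Bool) (j : Fin m) :
    g.onVertex x (g.dir j) = xor (g.corner (g.dir j)) (x j) := by
  simp [onVertex]

theorem onVertex_comp {k m n : ℕ} (g : CubeMap m n) (h : CubeMap k m) (x : Fin k → Bool) :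
    (g.comp h).onVertex x = g.onVertex (h.onVertex x) := by
  funext i
  by_cases hi : ∃ j, g.dir j = i
  · obtain ⟨j, rfl⟩ := hi
    rw [onVertex_dir]
    simp [onVertex, comp]
  · push Not at hi
    simp [onVertex, comp, hi]

theorem onVertex_update {m n : ℕ} (g : CubeMap m n) (x : Fin m → Bool) (j : Fin m) (b : Bool) :
    g.onVertex (Function.update x j b) =
      Function.update (g.onVertex x) (g.dir j) (xor (g.corner (g.dir j)) b) := by
  funext i
  by_cases hi : ∃ l, g.dir l = i
  · obtain ⟨l, rfl⟩ := hi
    rw [onVertex_dir]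
    by_cases hl : l = j
    · subst hl; simp
    · simp [Function.update_of_ne hl, Function.update_of_ne (g.dir.injective.ne hl), onVertex_dir]
  · push Not at hi
    rw [Function.update_of_ne (fun h => hi j h.symm)]
    simp [onVertex, hi]

end CubeMap

/-- A cube complex, given by its sets of parametrized cubes.  The last axiom says that no cube is
folded: different parametrizations of a cube are different maps. -/
structure CubeComplex where
  Cube : ℕ → Type u
  restrict : ∀ {m n : ℕ}, CubeMap m n → Cube n → Cube m
  restrict_id : ∀ {n : ℕ} (c : Cube n), restrict (CubeMap.id n) c = c
  restrict_comp : ∀ {k m n : ℕ} (g : CubeMap m n) (h : CubeMap k m) (c : Cube n),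
    restrict (g.comp h) c = restrict h (restrict g c)
  free : ∀ {n : ℕ} (g : CubeMap n n) (c : Cube n), restrict g c = c → g = CubeMap.id n

namespace CubeComplex

variable (X : CubeComplex.{u})

/-- The vertex of the cube `c` at the corner `x`. -/
def vertexOf {n : ℕ} (c : X.Cube n) (x : Fin n → Bool) : X.Cube 0 :=
  X.restrict (CubeMap.vertex x) c

/-- The (oriented) edge of the cube `c` that starts at the corner `x` and moves in direction `i`. -/
def edgeOf {n : ℕ} (c : X.Cube n) (i : Fin n) (x : Fin n → Bool) : X.Cube 1 :=
  X.restrict (CubeMap.edge i x) c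

/-- The initial vertex of an oriented edge. -/
def source (e : X.Cube 1) : X.Cube 0 := X.vertexOf e (fun _ => false)

/-- The terminal vertex of an oriented edge. -/
def target (e : X.Cube 1) : X.Cube 0 := X.vertexOf e (fun _ => true)

/-- The same edge with the opposite orientation. -/
def rev (e : X.Cube 1) : X.Cube 1 := X.edgeOf e 0 (fun _ => true)

/-- The edge `(0,0) → (1,0)` of a parametrized square. -/
def bottom (s : X.Cube 2) : X.Cube 1 := X.edgeOf s 0 ![false, false]
/-- The edge `(0,1) → (1,1)` of a parametrized square. -/
def top (s : X.Cube 2) : X.Cube 1 := X.edgeOf s 0 ![false, true]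
/-- The edge `(0,0) → (0,1)` of a parametrized square. -/
def left (s : X.Cube 2) : X.Cube 1 := X.edgeOf s 1 ![false, false]
/-- The edge `(1,0) → (1,1)` of a parametrized square. -/
def right (s : X.Cube 2) : X.Cube 1 := X.edgeOf s 1 ![true, false]

/-! ### Hyperplanes -/

/-- Parallelism of oriented edges: generated by being opposite, equally oriented, edges of a
square.  A class is a hyperplane with a transverse orientation. -/
def Parallel : X.Cube 1 → X.Cube 1 → Prop :=
  Relation.EqvGen (fun e e' => ∃ s : X.Cube 2, X.bottom s = e ∧ X.top s = e')

/-- Hyperplanes, as classes of unoriented edges (the edges dual to the hyperplane). -/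
def Hyperplane : Type u :=
  Quot (fun e e' : X.Cube 1 => (∃ s : X.Cube 2, X.bottom s = e ∧ X.top s = e') ∨ X.rev e = e')

/-- The hyperplane dual to an edge. -/
def dual (e : X.Cube 1) : X.Hyperplane := Quot.mk _ e

/-- `K` and `L` cross: some square contains a midcube of `K` and the other midcube lies in `L`. -/
def Cross (K L : X.Hyperplane) : Prop :=
  ∃ s : X.Cube 2, X.dual (X.bottom s) = K ∧ X.dual (X.left s) = L

/-- `K ∩ L ≠ ∅`. -/
def Meet (K L : X.Hyperplane) : Prop := K = L ∨ X.Cross K L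

/-- The connected components of the complement `X ∖ ⋃ 𝓗` of a set of hyperplanes.  Every component
contains a vertex, and two vertices are in the same one if and only if an edge path joins them
that crosses no hyperplane of `𝓗`. -/
def Component (𝓗 : Set X.Hyperplane) : Type u :=
  Quot (fun x y : X.Cube 0 => ∃ e : X.Cube 1, X.dual e ∉ 𝓗 ∧ X.source e = x ∧ X.target e = y)

/-- The component of `X ∖ ⋃ 𝓗` that contains the vertex `x`. -/
def component (𝓗 : Set X.Hyperplane) (x : X.Cube 0) : X.Component 𝓗 := Quot.mk _ x

/-- `⋃ 𝓗` separates `X`: its complement has more than one component. -/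
def Separates (𝓗 : Set X.Hyperplane) : Prop := Nontrivial (X.Component 𝓗)

/-- The hyperplane `L` is contained in the component `C` of `X ∖ ⋃ 𝓗`: it meets no hyperplane of
`𝓗`, and the edges dual to it lie in `C`. -/
def ContainedIn {𝓗 : Set X.Hyperplane} (L : X.Hyperplane) (C : X.Component 𝓗) : Prop :=
  (∀ K ∈ 𝓗, ¬ X.Meet L K) ∧
    ∀ e : X.Cube 1, X.dual e = L →
      X.component 𝓗 (X.source e) = C ∧ X.component 𝓗 (X.target e) = C

/-- Removing the hyperplane `L` does not disconnect the component `C` of `X ∖ ⋃ 𝓗`. -/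
def NonSeparatingIn {𝓗 : Set X.Hyperplane} (L : X.Hyperplane) (C : X.Component 𝓗) : Prop :=
  ∀ x y : X.Cube 0, X.component 𝓗 x = C → X.component 𝓗 y = C →
    X.component (insert L 𝓗) x = X.component (insert L 𝓗) y

/-! ### Compact special cube complexes -/

/-- Finitely many cubes. -/
def IsCompact : Prop :=
  (∀ n, Finite (X.Cube n)) ∧ ∃ N, ∀ n, N < n → IsEmpty (X.Cube n)

/-- `e` and `e'` are the two edges at a corner of some square, i.e. they are joined by an edge in
the link of their common initial vertex. -/
def SpanSquare (e e' : X.Cube 1) : Prop := ∃ s : X.Cube 2, X.bottom s = e ∧ X.left s = e'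

/-- Gromov's link condition: the link of every vertex is a flag simplicial complex.  The vertices of
the link of `x` are the oriented edges that start at `x`; the first clause excludes loops in links,
and the second says that any `n` pairwise adjacent vertices of a link span exactly one simplex. -/
def IsNPC : Prop :=
  (∀ s : X.Cube 2, X.bottom s ≠ X.left s) ∧
  ∀ (n : ℕ) (x : X.Cube 0) (e : Fin n → X.Cube 1), (∀ i, X.source (e i) = x) →
    (∀ i j, i ≠ j → X.SpanSquare (e i) (e j)) →
    ∃! c : X.Cube n, X.vertexOf c (fun _ => false) = x ∧
      ∀ i, X.edgeOf c i (fun _ => false) = e i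

/-- Special cube complexes: non-positively curved, and without one-sided, self-intersecting,
directly self-osculating or inter-osculating hyperplanes. -/
structure IsSpecial : Prop where
  npc : X.IsNPC
  two_sided : ∀ e : X.Cube 1, ¬ X.Parallel e (X.rev e)
  embedded : ∀ K : X.Hyperplane, ¬ X.Cross K K
  no_self_osculation : ∀ e e' : X.Cube 1, X.Parallel e e' → X.source e = X.source e' → e = e'
  no_inter_osculation : ∀ e e' : X.Cube 1, X.Cross (X.dual e) (X.dual e') →
    X.source e = X.source e' → X.SpanSquare e e'

/-! ### First homology and the intersection product -/

/-- The boundary of 1-chains. -/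
noncomputable def boundary : (X.Cube 1 →₀ ℤ) →ₗ[ℤ] (X.Cube 0 →₀ ℤ) :=
  Finsupp.linearCombination ℤ
    (fun e => Finsupp.single (X.target e) 1 - Finsupp.single (X.source e) 1)

/-- The boundary of a parametrized square. -/
noncomputable def squareBoundary (s : X.Cube 2) : X.Cube 1 →₀ ℤ :=
  Finsupp.single (X.bottom s) 1 + Finsupp.single (X.right s) 1
    - Finsupp.single (X.top s) 1 - Finsupp.single (X.left s) 1

/-- The relations `e + ē = 0` (which turn the free group on oriented edges into the group of
cellular 1-chains) and `∂s = 0`. -/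
noncomputable def boundaryRelations : Submodule ℤ (X.Cube 1 →₀ ℤ) :=
  Submodule.span ℤ
    (Set.range (fun e : X.Cube 1 => Finsupp.single e (1 : ℤ) + Finsupp.single (X.rev e) 1) ∪
      Set.range X.squareBoundary)

/-- `H₁(X)`: cellular homology with integer coefficients. -/
abbrev H1 : Type u :=
  LinearMap.ker X.boundary ⧸ X.boundaryRelations.submoduleOf (LinearMap.ker X.boundary)

theorem rev_rev (e : X.Cube 1) : X.rev (X.rev e) = e := by
  unfold rev edgeOf
  rw [← X.restrict_comp]
  have h : (CubeMap.edge (0 : Fin 1) fun _ => true).comp (CubeMap.edge (0 : Fin 1) fun _ => true)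
      = CubeMap.id 1 := by
    ext i
    · fin_cases i; decide
    · exact congrArg Fin.val (Subsingleton.elim _ _)
  rw [h, X.restrict_id]

/-- A change of parametrization of the square. -/
theorem edgeOf_restrict {m n : ℕ} (g : CubeMap m n) (c : X.Cube n) (i : Fin m)
    (x : Fin m → Bool) :
    X.edgeOf (X.restrict g c) i x = X.edgeOf c (g.dir i) (g.onVertex x) := by
  unfold edgeOf
  rw [← X.restrict_comp]
  rfl

theorem parallel_of_square_left (s : X.Cube 2) : X.Parallel (X.left s) (X.right s) := by
  let g : CubeMap 2 2 := ⟨fun _ => false, (Equiv.swap (0 : Fin 2) 1).toEmbedding⟩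
  refine Relation.EqvGen.rel _ _ ⟨X.restrict g s, ?_, ?_⟩
  · unfold bottom left
    rw [edgeOf_restrict]
    congr 1
    decide
  · unfold top right
    rw [edgeOf_restrict]
    congr 1
    decide

theorem rev_edgeOf {n : ℕ} (c : X.Cube n) (i : Fin n) (x : Fin n → Bool) :
    X.rev (X.edgeOf c i x) = X.edgeOf c i ((CubeMap.edge i x).onVertex fun _ => true) := by
  unfold rev
  nth_rewrite 2 [edgeOf]
  rw [edgeOf_restrict]
  rfl

theorem parallel_rev {e e' : X.Cube 1} (h : X.Parallel e e') :
    X.Parallel (X.rev e) (X.rev e') := by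
  induction h with
  | rel a b hab =>
    obtain ⟨s, rfl, rfl⟩ := hab
    let g : CubeMap 2 2 := ⟨![true, false], Function.Embedding.refl _⟩
    refine Relation.EqvGen.rel _ _ ⟨X.restrict g s, ?_, ?_⟩
    · unfold bottom
      rw [edgeOf_restrict, rev_edgeOf]
      congr 1
      decide
    · unfold top
      rw [edgeOf_restrict, rev_edgeOf]
      congr 1
      decide
  | refl a => exact Relation.EqvGen.refl _
  | symm a b _ ih => exact Relation.EqvGen.symm _ _ ih
  | trans a b c _ _ ih ih' => exact Relation.EqvGen.trans _ _ _ ih ih'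

theorem parallel_congr {e a b : X.Cube 1} (h : X.Parallel a b) :
    X.Parallel e a ↔ X.Parallel e b :=
  ⟨fun h' => Relation.EqvGen.trans _ _ _ h' h,
    fun h' => Relation.EqvGen.trans _ _ _ h' (Relation.EqvGen.symm _ _ h)⟩

open Classical in
/-- The signed intersection of the edge `e'` with the hyperplane dual to `e`, transversely oriented
by `e`. -/
noncomputable def sign (e e' : X.Cube 1) : ℤ :=
  (if X.Parallel e e' then 1 else 0) - (if X.Parallel e (X.rev e') then 1 else 0)

/-- The signed intersection of 1-chains with the hyperplane dual to `e`, oriented by `e`. -/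
noncomputable def dualCochain (e : X.Cube 1) : (X.Cube 1 →₀ ℤ) →ₗ[ℤ] ℤ :=
  Finsupp.linearCombination ℤ (X.sign e)

theorem sign_rev (e e' : X.Cube 1) : X.sign e (X.rev e') = - X.sign e e' := by
  unfold sign
  rw [rev_rev]
  ring

theorem sign_congr (e : X.Cube 1) {a b : X.Cube 1} (h : X.Parallel a b) :
    X.sign e a = X.sign e b := by
  classical
  have h1 := X.parallel_congr (e := e) h
  have h2 := X.parallel_congr (e := e) (X.parallel_rev h)
  unfold sign
  exact congrArg₂ (fun s t : ℤ => s - t) (if_congr h1 rfl rfl) (if_congr h2 rfl rfl)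

theorem boundaryRelations_le (e : X.Cube 1) :
    X.boundaryRelations ≤ LinearMap.ker (X.dualCochain e) := by
  refine Submodule.span_le.2 ?_
  rintro z (⟨e', rfl⟩ | ⟨s, rfl⟩)
  · simp [dualCochain, sign_rev]
  · have h1 : X.sign e (X.bottom s) = X.sign e (X.top s) :=
      X.sign_congr e (Relation.EqvGen.rel _ _ ⟨s, rfl, rfl⟩)
    have h2 := X.sign_congr e (X.parallel_of_square_left s)
    simp [dualCochain, squareBoundary, h1, h2]

/-- The intersection product `α ↦ α.K` on `H₁(X)`, where `K` is the hyperplane dual to `e` with the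
transverse orientation given by `e`. -/
noncomputable def intersection (e : X.Cube 1) : X.H1 →ₗ[ℤ] ℤ :=
  Submodule.liftQ _ ((X.dualCochain e).comp (LinearMap.ker X.boundary).subtype)
    (fun _ hz => X.boundaryRelations_le e hz)

/-! ### Automorphisms -/

/-- Automorphisms of a cube complex: bijections of parametrized cubes that respect faces and
changes of parametrization. -/
@[ext]
structure Auto where
  map : ∀ n, Equiv.Perm (X.Cube n)
  map_restrict : ∀ {m n : ℕ} (g : CubeMap m n) (c : X.Cube n),
    map m (X.restrict g c) = X.restrict g (map n c)

variable {X}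

namespace Auto

variable (X) in
/-- The identity automorphism. -/
def id : X.Auto := ⟨fun _ => Equiv.refl _, fun _ _ => rfl⟩

/-- The induced map on 1-chains. -/
noncomputable def chainMap (f : X.Auto) : (X.Cube 1 →₀ ℤ) →ₗ[ℤ] (X.Cube 1 →₀ ℤ) :=
  Finsupp.lmapDomain ℤ ℤ (f.map 1)

theorem chainMap_single (f : X.Auto) (e : X.Cube 1) (a : ℤ) :
    f.chainMap (Finsupp.single e a) = Finsupp.single (f.map 1 e) a := by
  simp [chainMap]

theorem boundary_chainMap (f : X.Auto) :
    X.boundary ∘ₗ f.chainMap = Finsupp.lmapDomain ℤ ℤ (f.map 0) ∘ₗ X.boundary := by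
  refine Finsupp.lhom_ext fun e a => ?_
  have h1 : X.source (f.map 1 e) = f.map 0 (X.source e) := (f.map_restrict _ _).symm
  have h2 : X.target (f.map 1 e) = f.map 0 (X.target e) := (f.map_restrict _ _).symm
  simp [chainMap_single, boundary, h1, h2, Finsupp.mapDomain_single, Finsupp.mapDomain_sub]

theorem chainMap_mem_ker (f : X.Auto) (z : X.Cube 1 →₀ ℤ) (hz : z ∈ LinearMap.ker X.boundary) :
    f.chainMap z ∈ LinearMap.ker X.boundary := by
  have h := LinearMap.congr_fun f.boundary_chainMap z
  simp only [LinearMap.comp_apply] at h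
  rw [LinearMap.mem_ker] at hz ⊢
  rw [h, hz, map_zero]

theorem boundaryRelations_le_comap (f : X.Auto) :
    X.boundaryRelations ≤ X.boundaryRelations.comap f.chainMap := by
  refine Submodule.span_le.2 ?_
  rintro z (⟨e, rfl⟩ | ⟨s, rfl⟩)
  · have h : X.rev (f.map 1 e) = f.map 1 (X.rev e) := (f.map_restrict _ _).symm
    refine Submodule.subset_span (Or.inl ⟨f.map 1 e, ?_⟩)
    simp [chainMap_single, h]
  · refine Submodule.subset_span (Or.inr ⟨f.map 2 s, ?_⟩)
    have h1 : X.bottom (f.map 2 s) = f.map 1 (X.bottom s) := (f.map_restrict _ _).symm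
    have h2 : X.top (f.map 2 s) = f.map 1 (X.top s) := (f.map_restrict _ _).symm
    have h3 : X.left (f.map 2 s) = f.map 1 (X.left s) := (f.map_restrict _ _).symm
    have h4 : X.right (f.map 2 s) = f.map 1 (X.right s) := (f.map_restrict _ _).symm
    simp [squareBoundary, chainMap_single, h1, h2, h3, h4]

/-- The induced map `f_* : H₁(X) → H₁(X)`. -/
noncomputable def onH1 (f : X.Auto) : X.H1 →ₗ[ℤ] X.H1 :=
  Submodule.mapQ _ _ (f.chainMap.restrict f.chainMap_mem_ker)
    (fun _ hz => f.boundaryRelations_le_comap hz)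

end Auto

variable (X)

/-! ### The three conditions of the criterion -/

/-- Two different hyperplanes with nonempty intersection are distinguished by a homology class,
whatever their transverse orientations. -/
def CrossingCondition : Prop :=
  ∀ K₁ K₂ : X.Hyperplane, K₁ ≠ K₂ → X.Meet K₁ K₂ →
    ∃ α : X.H1, ∀ e₁ e₂ : X.Cube 1, X.dual e₁ = K₁ → X.dual e₂ = K₂ →
      X.intersection e₁ α ≠ X.intersection e₂ α

/-- If two disjoint hyperplanes `K₁`, `K₂` together separate `X`, then every component of
`X ∖ (K₁ ∪ K₂)` contains a hyperplane that does not meet `K₁` or `K₂` and that is non-separating,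
both in `X` and in this component. -/
def SeparatingPairCondition : Prop :=
  ∀ K₁ K₂ : X.Hyperplane, ¬ X.Meet K₁ K₂ → X.Separates {K₁, K₂} →
    ∀ C : X.Component {K₁, K₂}, ∃ L : X.Hyperplane,
      X.ContainedIn L C ∧ ¬ X.Separates {L} ∧ X.NonSeparatingIn L C

/-- An automorphism that maps every transversely oriented hyperplane to itself is the identity. -/
def HyperplaneRigidity : Prop :=
  ∀ f : X.Auto, (∀ e : X.Cube 1, X.Parallel e (f.map 1 e)) → f = Auto.id X

end CubeComplex

/-! ## Whitehead partitions -/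

section Whitehead

variable {V : Type u} (Γ : SimpleGraph V)

/-- The inverse on `V^±`, the set of generators `(v, false) = v` and inverses `(v, true) = v⁻¹`. -/
def litInv (x : V × Bool) : V × Bool := (x.1, !x.2)

/-- `v ≤ w`: `lk(v) ⊆ st(w)`. -/
def Dominated (v w : V) : Prop := Γ.neighborSet v ⊆ insert w (Γ.neighborSet w)

/-- `Γ`-Whitehead pairs `(P, m)`. -/
structure IsWhiteheadPair (P : Set (V × Bool)) (m : V × Bool) : Prop where
  nontrivial : P.Nontrivial
  mem : m ∈ P
  inv_notMem : litInv m ∉ P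
  not_adj : ∀ x ∈ P, ¬ Γ.Adj m.1 x.1
  single_le : ∀ x ∈ P, litInv x ∉ P → Dominated Γ x.1 m.1
  component : ∀ v w : ↥((insert m.1 (Γ.neighborSet m.1))ᶜ : Set V),
    (Γ.induce ((insert m.1 (Γ.neighborSet m.1))ᶜ : Set V)).Reachable v w →
    ((v : V), false) ∈ P → ((v : V), true) ∈ P → ((w : V), false) ∈ P ∧ ((w : V), true) ∈ P

/-- `lk(m)^±`. -/
def litLink (m : V × Bool) : Set (V × Bool) := {x | Γ.Adj m.1 x.1}

/-- A `Γ`-Whitehead partition `V^± = P ⊔ lk(P) ⊔ P*`, with one of its two sides called `P`.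
Both `(P, m)` and `(P*, m⁻¹)` are Whitehead pairs; in particular both sides have at least two
elements.  The base `m` is only recorded to write down `lk(P) = lk(m)^±`, which does not depend on
its choice. -/
structure WhiteheadPartition where
  P : Set (V × Bool)
  base : V × Bool
  isPair : IsWhiteheadPair Γ P base
  isPair_compl : IsWhiteheadPair Γ (P ∪ litLink Γ base)ᶜ (litInv base)

namespace WhiteheadPartition

variable {Γ}

/-- `lk(P)`. -/
def link (p : WhiteheadPartition Γ) : Set (V × Bool) := litLink Γ p.base

/-- The sides: `side false = P` and `side true = P*`. -/
def side (p : WhiteheadPartition Γ) : Bool → Set (V × Bool)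
  | false => p.P
  | true => (p.P ∪ p.link)ᶜ

/-- `max(P)`: the singles of `P` that are equivalent to the base. -/
def max (p : WhiteheadPartition Γ) : Set (V × Bool) :=
  {x | x ∈ p.P ∧ litInv x ∉ p.P ∧ Dominated Γ x.1 p.base.1 ∧ Dominated Γ p.base.1 x.1}

/-- `P` and `Q` commute: `max(P)` and `max(Q)` consist of distinct commuting generators. -/
def Commute (p q : WhiteheadPartition Γ) : Prop :=
  ∀ x ∈ p.max, ∀ y ∈ q.max, Γ.Adj x.1 y.1

/-- Compatibility of partitions. -/
def Compatible (p q : WhiteheadPartition Γ) : Prop :=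
  p.Commute q ∨ ∃ a b : Bool, p.side a ∩ q.side b = ∅

/-- A compatible collection of (pairwise distinct) partitions.  As partitions, `p` and `q` are equal
if and only if `P = Q` or `P = Q*`. -/
def IsCompatibleCollection {k : ℕ} (p : Fin k → WhiteheadPartition Γ) : Prop :=
  ∀ i j, i ≠ j → (∀ b, (p i).side false ≠ (p j).side b) ∧ (p i).Compatible (p j)

theorem base_mem_max (p : WhiteheadPartition Γ) : p.base ∈ p.max :=
  ⟨p.isPair.mem, p.isPair.inv_notMem, Set.subset_insert _ _, Set.subset_insert _ _⟩

theorem litInv_mem_link (p : WhiteheadPartition Γ) (x : V × Bool) :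
    litInv x ∈ p.link ↔ x ∈ p.link := Iff.rfl

theorem litInv_litInv (x : V × Bool) : litInv (litInv x) = x := by
  simp [litInv]

theorem side_not (p : WhiteheadPartition Γ) (b : Bool) :
    p.side (!b) = (p.side b ∪ p.link)ᶜ := by
  cases b
  · rfl
  · ext x
    have h : x ∈ p.P → x ∉ p.link := fun hx => p.isPair.not_adj x hx
    simp only [side, Bool.not_true, Set.mem_compl_iff, Set.mem_union]
    tauto

end WhiteheadPartition

/-! ## Blow-ups -/

open WhiteheadPartition

variable {Γ} {k : ℕ} (p : Fin k → WhiteheadPartition Γ)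

/-- Regions: consistent choices of sides.  These are the vertices of the blow-up. -/
def Region : Type :=
  {R : Fin k → Bool //
    ∀ i j, (p i).Commute (p j) ∨ ((p i).side (R i) ∩ (p j).side (R j)).Nonempty}

/-- `I(R)`, the intersection of the sets `P_i^× ∪ lk(P_i)`. -/
def regionLits (R : Region p) : Set (V × Bool) :=
  {x | ∀ i, x ∈ (p i).side (R.1 i) ∪ (p i).link}

/-- Commuting labels: `Sum.inl v` is a generator, `Sum.inr i` is the partition `P_i`. -/
def LabelCommute : V ⊕ Fin k → V ⊕ Fin k → Prop
  | Sum.inl v, Sum.inl w => Γ.Adj v w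
  | Sum.inl v, Sum.inr i => (v, false) ∈ (p i).link
  | Sum.inr i, Sum.inl v => (v, false) ∈ (p i).link
  | Sum.inr i, Sum.inr j => i ≠ j ∧ (p i).Commute (p j)

/-- There is an oriented edge from `R` to `R'` with the given oriented label.
The label `(v, b)` with `v` a generator stands for `v` or `v⁻¹`: it has to lie in `I(R)`, and `R'`
arises from `R` by switching the sides in which it is a single (no side if both `v` and `v⁻¹` lie in
`I(R)`, in which case the edge is a loop).
The label `P_i` leads from the side `P_i` to the side `P_i*` (`b = false`) or back (`b = true`). -/
def IsBlowupEdge (R R' : Region p) : (V ⊕ Fin k) × Bool → Prop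
  | (Sum.inl v, b) => (v, b) ∈ regionLits p R ∧
      ∀ i, R'.1 i ≠ R.1 i ↔ (v, b) ∈ (p i).side (R.1 i) ∧ litInv (v, b) ∉ (p i).side (R.1 i)
  | (Sum.inr i, b) => R.1 i = b ∧ ∀ j, R'.1 j ≠ R.1 j ↔ j = i

/-- A parametrized `n`-cube of the blow-up: a map of the 1-skeleton of `[0,1]^n` such that the
parallel edges in each coordinate direction carry one oriented label, and the `n` labels pairwise
commute. -/
@[ext]
structure BlowupCube (n : ℕ) where
  vert : (Fin n → Bool) → Region p
  label : Fin n → (V ⊕ Fin k) × Bool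
  commute : ∀ i j, i ≠ j → LabelCommute p (label i).1 (label j).1
  isEdge : ∀ (x : Fin n → Bool) (i : Fin n),
    IsBlowupEdge p (vert (Function.update x i false)) (vert (Function.update x i true)) (label i)

theorem labelCommute_irrefl (l : V ⊕ Fin k) : ¬ LabelCommute p l l := by
  cases l with
  | inl v => exact Γ.irrefl
  | inr i => exact fun h => h.1 rfl

theorem IsBlowupEdge.reverse {R R' : Region p} {l : V ⊕ Fin k} {b : Bool}
    (h : IsBlowupEdge p R R' (l, b)) : IsBlowupEdge p R' R (l, !b) := by
  cases l with
  | inr i =>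
    obtain ⟨h1, h2⟩ := h
    refine ⟨?_, fun j => ?_⟩
    · have := (h2 i).2 rfl
      rw [h1] at this
      cases b <;> simpa using this
    · rw [← h2 j, ne_comm]
  | inl v =>
    obtain ⟨h1, h2⟩ := h
    have key : ∀ i, (v, !b) ∈ (p i).side (R'.1 i) ∪ (p i).link ∧
        (R.1 i ≠ R'.1 i ↔ (v, !b) ∈ (p i).side (R'.1 i) ∧ (v, b) ∉ (p i).side (R'.1 i)) := by
      intro i
      have a1 := h1 i
      have a2 := h2 i
      have a3 : (v, !b) ∈ (p i).link ↔ (v, b) ∈ (p i).link := Iff.rfl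
      change _ ↔ (v, b) ∈ _ ∧ (v, !b) ∉ _ at a2
      have dis : ∀ y, y ∈ (p i).side (R.1 i) → y ∉ (p i).link := by
        intro y hy hl
        have := (p i).side_not (!(R.1 i))
        rw [Bool.not_not] at this
        rw [this] at hy
        exact hy (Or.inr hl)
      by_cases hR : R'.1 i = R.1 i
      · rw [hR]
        simp only [hR, ne_eq, not_true_eq_false, false_iff, not_and, not_not] at a2
        have b1 := dis (v, !b)
        simp only [Set.mem_union] at a1 ⊢
        simp only [ne_eq, not_true_eq_false, false_iff]
        tauto
      · have hR' : R'.1 i = !(R.1 i) := by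
          revert hR
          cases R'.1 i <;> cases R.1 i <;> simp
        have b0 := a2.1 hR
        have b1 := dis (v, b)
        rw [hR', (p i).side_not]
        simp only [Set.mem_union, Set.mem_compl_iff]
        have : R.1 i ≠ !(R.1 i) := by cases R.1 i <;> simp
        tauto
    refine ⟨fun i => (key i).1, fun i => ?_⟩
    have e : litInv (v, !b) = (v, b) := by simp [litInv]
    rw [e]
    exact (key i).2

/-- Restriction of a parametrized cube to a face. -/
def BlowupCube.restrict {m n : ℕ} (g : CubeMap m n) (c : BlowupCube p n) : BlowupCube p m where
  vert x := c.vert (g.onVertex x)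
  label j := ((c.label (g.dir j)).1, xor (g.corner (g.dir j)) (c.label (g.dir j)).2)
  commute i j h := c.commute _ _ (g.dir.injective.ne h)
  isEdge x j := by
    have h := c.isEdge (g.onVertex x) (g.dir j)
    rw [g.onVertex_update, g.onVertex_update]
    cases g.corner (g.dir j)
    · simpa using h
    · simpa using h.reverse

/-- The blow-up of the Salvetti complex of `Γ` along the collection `p` of partitions.  (For the
empty collection, `k = 0`, this is the Salvetti complex itself.) -/
def blowup : CubeComplex.{u} where
  Cube := BlowupCube p
  restrict g c := BlowupCube.restrict p g c
  restrict_id c := by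
    ext1
    · funext x
      simp [BlowupCube.restrict, CubeMap.onVertex_id]
    · funext j
      simp [BlowupCube.restrict, CubeMap.id]
  restrict_comp g h c := by
    ext1
    · funext x
      simp [BlowupCube.restrict, CubeMap.onVertex_comp]
    · funext j
      simp only [BlowupCube.restrict, CubeMap.comp, Function.Embedding.trans_apply,
        CubeMap.onVertex_dir]
      rw [Bool.xor_comm (g.corner _), Bool.xor_assoc]
  free {n} g c h := by
    have hl : ∀ j, ((c.label (g.dir j)).1, xor (g.corner (g.dir j)) (c.label (g.dir j)).2)
        = c.label j := fun j => congrFun (congrArg BlowupCube.label h) j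
    have hd : ∀ j, g.dir j = j := by
      intro j
      by_contra hne
      have hc := c.commute _ _ hne
      rw [congrArg Prod.fst (hl j)] at hc
      exact labelCommute_irrefl p _ hc
    ext j
    · have h2 := congrArg Prod.snd (hl j)
      simp only [hd] at h2
      revert h2
      simp only [CubeMap.id]
      cases g.corner j <;> cases (c.label j).2 <;> simp
    · simp [hd, CubeMap.id]

end Whitehead

/-!
The whole proof rests on a description of the hyperplanes of the blow-up by labels.

Call two sides `P_i^×` and `P_j^×` of non-commuting partitions disjoint if they do not meet; reading
this as `P_i^× ≤ (P_j^×)*` gives a partial order on the sides of a compatible collection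
(`IsCompatibleCollection.disj_trans`), and a region is a choice of sides no two of which are
disjoint.  Transitivity has two consequences.  Consistent choices of some of the sides extend to
regions (`exists_region`), which produces enough edges, and two regions are joined by a path along
which each side in which they differ is switched once (`exists_flip`, `induction_toward`).

If a label switches the side of `P_i`, then every label commuting with it commutes with `P_i`
(`IsBlowupEdge.commute_of_flip`).  Hence edges with pairwise commuting labels at one region always
span a cube (`exists_cube`), and two edges are parallel if and only if they carry the same oriented
label (`parallel_iff`).  Specialness follows, as does rigidity: an automorphism that preserves the
labels is the identity (`eq_id_of_edgeLabel`).

Closing up an edge labelled `v` by a path along edges labelled by partitions gives a loop that meets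
`K_v` once and meets the hyperplane of a partition, with a sign, exactly when `v` is a single of it
(`exists_loop`, `loopNumber`).  These loops distinguish crossing hyperplanes.  If the hyperplanes of
two labels separate, then there are few singles that lead from one part of the complement to
another, and a generator that is not such a single provides the required hyperplane (`IsWitness`).

Finally, let `f` act trivially on homology.  Then `f` maps each oriented hyperplane to one with the
same intersection numbers.  The hyperplanes in such a homology class are disjoint and arranged
cyclically; the position of a region in this arrangement is encoded by its `level` modulo the size
of the class, and `f` rotates the arrangement (`dvd_level_autoRegion`).  If the rotation is trivial,
then `f` preserves all labels in the class.  Otherwise there is a generator `w` whose hyperplane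
lies in one of the pieces (`exists_generator_between`); a loop in this piece that meets `K_w` once
is moved off `K_w` by `f`, although its homology class is fixed (`edgeLabel_map`).
-/

/-! ### Sides of Whitehead partitions -/

namespace WhiteheadPartition

variable {V : Type u} {Γ : SimpleGraph V}

/-- The base of the side `p.side b`: the base `m` of `P`, respectively the base `m⁻¹` of `P*`. -/
def sideBase (p : WhiteheadPartition Γ) (b : Bool) : V × Bool := (p.base.1, xor p.base.2 b)

theorem litInv_sideBase (p : WhiteheadPartition Γ) (b : Bool) :
    litInv (p.sideBase b) = p.sideBase (!b) := by
  simp [sideBase, litInv]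

theorem isPair_side (p : WhiteheadPartition Γ) (b : Bool) :
    IsWhiteheadPair Γ (p.side b) (p.sideBase b) := by
  cases b
  · simpa [side, sideBase] using p.isPair
  · simpa [side, sideBase, litInv, link] using p.isPair_compl

theorem sideBase_mem (p : WhiteheadPartition Γ) (b : Bool) : p.sideBase b ∈ p.side b :=
  (p.isPair_side b).mem

theorem mem_link {p : WhiteheadPartition Γ} {x : V × Bool} :
    x ∈ p.link ↔ Γ.Adj p.base.1 x.1 := Iff.rfl

theorem notMem_link {p : WhiteheadPartition Γ} {b : Bool} {x : V × Bool} (h : x ∈ p.side b) :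
    x ∉ p.link := (p.isPair_side b).not_adj x h

theorem mem_side_not {p : WhiteheadPartition Γ} {b : Bool} {x : V × Bool} :
    x ∈ p.side (!b) ↔ x ∉ p.side b ∧ x ∉ p.link := by
  rw [side_not]; simp

theorem mem_side_or (p : WhiteheadPartition Γ) (b : Bool) {x : V × Bool} (h : x ∉ p.link) :
    x ∈ p.side b ∨ x ∈ p.side (!b) := by
  rw [mem_side_not]; tauto

theorem notMem_side {p : WhiteheadPartition Γ} {b : Bool} {x : V × Bool} (h : x ∈ p.side b) :
    x ∉ p.side (!b) := fun h' => (mem_side_not.1 h').1 h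

/-- A literal off the link lies in exactly one side. -/
theorem eq_of_mem_side {p : WhiteheadPartition Γ} {a b : Bool} {x : V × Bool} (h : x ∈ p.side a)
    (h' : x ∈ p.side b) : a = b := by
  by_contra hne
  have : b = !a := by cases a <;> cases b <;> simp_all
  subst this
  exact notMem_side h h'

theorem exists_mem_side {p : WhiteheadPartition Γ} {x : V × Bool} (h : x ∉ p.link) :
    ∃ b, x ∈ p.side b :=
  (p.mem_side_or false h).elim (fun h => ⟨_, h⟩) fun h => ⟨_, h⟩

theorem litInv_notMem_link {p : WhiteheadPartition Γ} {b : Bool} {x : V × Bool}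
    (h : x ∈ p.side b) : litInv x ∉ p.link := notMem_link (x := x) h

theorem dominated_of_single {p : WhiteheadPartition Γ} {b : Bool} {x : V × Bool}
    (h : x ∈ p.side b) (h' : litInv x ∈ p.side (!b)) : Dominated Γ x.1 p.base.1 :=
  (p.isPair_side b).single_le x h (mem_side_not.1 h').1

theorem dominated_of_sideBase_single {p q : WhiteheadPartition Γ} {a b : Bool}
    (h : p.sideBase a ∈ q.side b) (h' : litInv (p.sideBase a) ∈ q.side (!b)) :
    Dominated Γ p.base.1 q.base.1 :=
  dominated_of_single (x := p.sideBase a) h h'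

/-- Everything adjacent to a single of a partition lies in the link of the partition. -/
theorem adj_base_of_single {p : WhiteheadPartition Γ} {b : Bool} {x : V × Bool}
    (h : x ∈ p.side b) (h' : litInv x ∈ p.side (!b)) {v : V} (hv : Γ.Adj x.1 v) :
    Γ.Adj p.base.1 v := by
  rcases dominated_of_single h h' hv with rfl | h1
  · exact absurd (SimpleGraph.Adj.symm hv) (notMem_link h)
  · exact h1

/-- Adjacent vertices off the star of the base lie, with their inverses, in the same side. -/
theorem mem_side_of_adj {p : WhiteheadPartition Γ} {b : Bool} {x : V × Bool}
    (h : x ∈ p.side b) {v : V} (hv : Γ.Adj x.1 v) (h' : ¬ Γ.Adj p.base.1 v) (c : Bool) :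
    (v, c) ∈ p.side b := by
  have hx : litInv x ∈ p.side b := by
    refine (p.mem_side_or b (litInv_notMem_link h)).resolve_right fun h2 => ?_
    exact h' (adj_base_of_single h h2 hv)
  have h1 : x.1 ∈ (insert p.base.1 (Γ.neighborSet p.base.1))ᶜ := by
    rintro (h1 | h1)
    · exact h' (h1 ▸ hv)
    · exact notMem_link h h1
  have h2 : v ∈ (insert p.base.1 (Γ.neighborSet p.base.1))ᶜ := by
    rintro (h2 | h2)
    · exact notMem_link h (mem_link.2 (h2 ▸ SimpleGraph.Adj.symm hv))
    · exact h' h2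
  have hb : (x.1, false) ∈ p.side b ∧ (x.1, true) ∈ p.side b := by
    obtain ⟨v, c⟩ := x
    cases c
    · exact ⟨h, hx⟩
    · exact ⟨hx, h⟩
  have key := (p.isPair_side b).component ⟨x.1, h1⟩ ⟨v, h2⟩
    (SimpleGraph.Adj.reachable (by simpa using hv)) hb.1 hb.2
  cases c
  · exact key.1
  · exact key.2

theorem commute_iff {p q : WhiteheadPartition Γ} :
    p.Commute q ↔ Γ.Adj p.base.1 q.base.1 := by
  refine ⟨fun h => h _ p.base_mem_max _ q.base_mem_max, fun h x hx y hy => ?_⟩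
  have h1 : Γ.Adj x.1 q.base.1 := by
    rcases hx.2.2.2 h with h1 | h1
    · exact absurd (h1 ▸ h) (p.isPair.not_adj x hx.1)
    · exact h1
  rcases hy.2.2.2 (SimpleGraph.Adj.symm h1) with h2 | h2
  · exact absurd (h2 ▸ SimpleGraph.Adj.symm h1) (q.isPair.not_adj y hy.1)
  · exact SimpleGraph.Adj.symm h2

theorem Commute.symm {p q : WhiteheadPartition Γ} (h : p.Commute q) : q.Commute p :=
  commute_iff.2 (SimpleGraph.Adj.symm (commute_iff.1 h))

theorem not_commute_self (p : WhiteheadPartition Γ) : ¬ p.Commute p :=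
  fun h => Γ.irrefl (commute_iff.1 h)

theorem sideBase_notMem_link {p q : WhiteheadPartition Γ} (h : ¬ p.Commute q) (a : Bool) :
    p.sideBase a ∉ q.link := fun h' => h (commute_iff.2 (SimpleGraph.Adj.symm h'))

/-- Partitions whose bases are singles of each other have the same link. -/
theorem link_eq_of_dominated {p q : WhiteheadPartition Γ} (h : ¬ p.Commute q)
    (h1 : Dominated Γ p.base.1 q.base.1) (h2 : Dominated Γ q.base.1 p.base.1) :
    p.link = q.link := by
  ext x
  constructor
  · intro hx
    rcases h1 hx with h' | h'
    · exact absurd (commute_iff.2 (by rw [← h']; exact hx)) h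
    · exact h'
  · intro hx
    rcases h2 hx with h' | h'
    · exact absurd (commute_iff.2 (by rw [← h']; exact hx)).symm h
    · exact h'

theorem side_eq_of_link_eq {p q : WhiteheadPartition Γ} {a b : Bool} (hl : p.link = q.link)
    (h : p.side a = q.side b) : p.side (!a) = q.side (!b) := by
  rw [side_not, side_not, h, hl]

/-- The sides `p.side a` and `q.side b` of non-commuting partitions are disjoint.  Read as
`p.side a ≤ q.side (!b)`, this is a partial order on the sides of a compatible collection. -/
def Disj (p : WhiteheadPartition Γ) (a : Bool) (q : WhiteheadPartition Γ) (b : Bool) : Prop :=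
  ¬ p.Commute q ∧ p.side a ∩ q.side b = ∅

theorem Disj.symm {p q : WhiteheadPartition Γ} {a b : Bool} (h : p.Disj a q b) : q.Disj b p a :=
  ⟨fun h' => h.1 h'.symm, by rw [Set.inter_comm]; exact h.2⟩

theorem disj_comm {p q : WhiteheadPartition Γ} {a b : Bool} : p.Disj a q b ↔ q.Disj b p a :=
  ⟨Disj.symm, Disj.symm⟩

theorem Disj.notMem {p q : WhiteheadPartition Γ} {a b : Bool} (h : p.Disj a q b) {x : V × Bool}
    (hx : x ∈ p.side a) : x ∉ q.side b := fun h' => by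
  have : x ∈ p.side a ∩ q.side b := ⟨hx, h'⟩
  rw [h.2] at this
  exact this

theorem disj_self {p : WhiteheadPartition Γ} {a b : Bool} : p.Disj a p b ↔ b = !a := by
  constructor
  · intro h
    by_contra hne
    have : b = a := by cases a <;> cases b <;> simp_all
    subst this
    exact h.notMem (p.sideBase_mem b) (p.sideBase_mem b)
  · rintro rfl
    refine ⟨p.not_commute_self, ?_⟩
    ext x
    simp only [Set.mem_inter_iff, Set.mem_empty_iff_false, iff_false, not_and]
    exact notMem_side

theorem Disj.sideBase_mem {p q : WhiteheadPartition Γ} {a b : Bool} (h : p.Disj a q b) :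
    p.sideBase a ∈ q.side (!b) :=
  mem_side_not.2 ⟨h.notMem (p.sideBase_mem a), sideBase_notMem_link h.1 a⟩

theorem Disj.not_right {p q : WhiteheadPartition Γ} {a b : Bool} (h : p.Disj a q b) :
    ¬ p.Disj a q (!b) := fun h' => h'.notMem (p.sideBase_mem a) h.sideBase_mem

/-- If two opposite pairs of sides are disjoint, the two partitions coincide. -/
theorem Disj.eq_of_not {p q : WhiteheadPartition Γ} {a b : Bool} (h : p.Disj a q b)
    (h' : p.Disj (!a) q (!b)) : p.link = q.link ∧ p.side a = q.side (!b) := by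
  have hl : p.link = q.link := by
    refine link_eq_of_dominated h.1 ?_ ?_
    · have h1 := h.sideBase_mem
      have h2 := h'.sideBase_mem
      rw [← litInv_sideBase] at h2
      exact dominated_of_sideBase_single h1 h2
    · have h1 := h.symm.sideBase_mem
      have h2 := h'.symm.sideBase_mem
      rw [← litInv_sideBase] at h2
      exact dominated_of_sideBase_single h1 h2
  refine ⟨hl, Set.Subset.antisymm (fun x hx => ?_) (fun x hx => ?_)⟩
  · exact mem_side_not.2 ⟨h.notMem hx, hl ▸ notMem_link hx⟩
  · have := mem_side_not.2 ⟨h'.symm.notMem hx, hl ▸ notMem_link hx⟩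
    rwa [Bool.not_not] at this

variable {k : ℕ} {p : Fin k → WhiteheadPartition Γ}

/-- Distinct partitions of a compatible collection have no side in common, provided that their
links agree. -/
theorem IsCompatibleCollection.side_ne (hp : IsCompatibleCollection p) {i j : Fin k} (h : i ≠ j)
    (hl : (p i).link = (p j).link) (a b : Bool) : (p i).side a ≠ (p j).side b := by
  cases a
  · exact (hp i j h).1 b
  · intro h'
    exact (hp i j h).1 (!b) (side_eq_of_link_eq hl h')

theorem IsCompatibleCollection.exists_disj (hp : IsCompatibleCollection p) {i j : Fin k}
    (h : i ≠ j) (hc : ¬ (p i).Commute (p j)) : ∃ a b, (p i).Disj a (p j) b := by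
  rcases (hp i j h).2 with h1 | ⟨a, b, h1⟩
  · exact absurd h1 hc
  · exact ⟨a, b, hc, h1⟩

theorem IsCompatibleCollection.eq_of_disj (hp : IsCompatibleCollection p) {i j : Fin k}
    {a b : Bool} (h : (p i).Disj a (p j) b) (h' : (p i).Disj (!a) (p j) (!b)) : i = j := by
  by_contra hne
  obtain ⟨hl, hs⟩ := h.eq_of_not h'
  exact hp.side_ne hne hl _ _ hs

/-- Non-commuting partitions separated by a third one do not commute: otherwise their bases,
being adjacent and not singles of the third partition, would lie on the same side of it. -/
theorem Disj.not_commute {p q r : WhiteheadPartition Γ} {a b c : Bool} (h : p.Disj a q b)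
    (h' : q.Disj (!b) r c) : ¬ p.Commute r := by
  intro hc
  have h1 : p.sideBase a ∈ q.side (!b) := h.sideBase_mem
  have h2 : r.sideBase c ∈ q.side b := by simpa using h'.symm.sideBase_mem
  have h3 := mem_side_of_adj h1 (v := r.base.1) (commute_iff.1 hc)
    (fun h4 => h'.1 (commute_iff.2 h4)) (r.sideBase c).2
  exact notMem_side h2 h3

/-- The order on the sides of a compatible collection is transitive. -/
theorem IsCompatibleCollection.disj_trans (hp : IsCompatibleCollection p) {i j l : Fin k}
    {a b c : Bool} (h : (p i).Disj a (p j) b) (h' : (p j).Disj (!b) (p l) c) :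
    (p i).Disj a (p l) c := by
  by_cases hij : i = j
  · subst hij
    rw [disj_self.1 h, Bool.not_not] at h'
    exact h'
  by_cases hjl : j = l
  · subst hjl
    have := disj_self.1 h'
    rw [Bool.not_not] at this
    rwa [this]
  have hnc := h.not_commute h'
  by_cases hil : i = l
  · subst hil
    have hc : c = !a := by
      by_contra hne
      have : c = a := by cases a <;> cases c <;> simp_all
      subst this
      exact h.not_right h'.symm
    exact disj_self.2 hc
  have x1 : (p i).sideBase a ∈ (p l).side (!c) :=
    mem_side_not.2 ⟨h'.notMem h.sideBase_mem, sideBase_notMem_link hnc a⟩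
  have x3 : (p l).sideBase c ∈ (p j).side b := by simpa using h'.symm.sideBase_mem
  have x3' : (p l).sideBase c ∈ (p i).side (!a) :=
    mem_side_not.2 ⟨h.symm.notMem x3, sideBase_notMem_link (fun h => hnc h.symm) c⟩
  obtain ⟨a', c', hd⟩ := hp.exists_disj hil hnc
  by_cases ha : a' = a
  · subst ha
    by_cases hc : c' = c
    · subst hc; exact hd
    · have : c' = !c := by cases c <;> cases c' <;> simp_all
      subst this
      exact absurd x1 (hd.notMem ((p i).sideBase_mem _))
  · have ha' : a' = !a := by cases a <;> cases a' <;> simp_all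
    subst ha'
    by_cases hc : c' = c
    · subst hc
      exact absurd x3' (hd.symm.notMem ((p l).sideBase_mem _))
    · have hc' : c' = !c := by cases c <;> cases c' <;> simp_all
      subst hc'
      -- The three sides contain each other cyclically, so that the three bases are equivalent.
      exfalso
      have y1 := h.sideBase_mem
      have y1' : litInv ((p i).sideBase a) ∈ (p j).side b := by
        rw [litInv_sideBase]
        have z : (p i).sideBase (!a) ∈ (p l).side c := by simpa using hd.sideBase_mem
        have := mem_side_not.2 ⟨h'.symm.notMem z, sideBase_notMem_link h.1 (!a)⟩
        simpa using this
      have y2 := h.symm.sideBase_mem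
      have y2' : litInv ((p j).sideBase b) ∈ (p i).side a := by
        rw [litInv_sideBase]
        have := mem_side_not.2 ⟨hd.symm.notMem h'.sideBase_mem,
          sideBase_notMem_link (fun h' => h.1 h'.symm) (!b)⟩
        simpa using this
      have y3 : litInv ((p l).sideBase c) ∈ (p j).side (!b) := by
        rw [litInv_sideBase]
        have z : (p l).sideBase (!c) ∈ (p i).side a := by simpa using hd.symm.sideBase_mem
        exact mem_side_not.2 ⟨h.notMem z, sideBase_notMem_link (fun h => h'.1 h.symm) (!c)⟩
      have y4 : (p j).sideBase (!b) ∈ (p l).side (!c) := h'.sideBase_mem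
      have y4' : litInv ((p j).sideBase (!b)) ∈ (p l).side c := by
        rw [litInv_sideBase, Bool.not_not]
        have z : (p j).sideBase b ∈ (p i).side (!a) := y2
        have := mem_side_not.2 ⟨hd.notMem z, sideBase_notMem_link h'.1 b⟩
        simpa using this
      have lij : (p i).link = (p j).link :=
        link_eq_of_dominated h.1 (dominated_of_sideBase_single y1 (by simpa using y1'))
          (dominated_of_sideBase_single y2 (by simpa using y2'))
      have ljl : (p j).link = (p l).link :=
        link_eq_of_dominated h'.1 (dominated_of_sideBase_single y4 (by simpa using y4'))
          (dominated_of_sideBase_single x3 y3)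
      refine hp.side_ne hij lij a (!b) (Set.Subset.antisymm (fun x hx => ?_) (fun x hx => ?_))
      · exact mem_side_not.2 ⟨h.notMem hx, lij ▸ notMem_link hx⟩
      · have z := mem_side_not.2 ⟨h'.notMem hx, ljl ▸ notMem_link hx⟩
        have := mem_side_not.2 ⟨hd.symm.notMem z, lij ▸ notMem_link hx⟩
        simpa using this

end WhiteheadPartition

/-! ### Edges and cubes of the blow-up -/

section BlowupCubes

open WhiteheadPartition

variable {V : Type u} {Γ : SimpleGraph V} {k : ℕ} {p : Fin k → WhiteheadPartition Γ}

theorem Region.ext {R S : Region p} (h : ∀ i, R.1 i = S.1 i) : R = S :=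
  Subtype.ext (funext h)

theorem Region.not_disj (R : Region p) (i j : Fin k) : ¬ (p i).Disj (R.1 i) (p j) (R.1 j) := by
  rintro ⟨h1, h2⟩
  rcases R.2 i j with h | h
  · exact h1 h
  · exact h.ne_empty h2

/-- Regions are the choices of sides without disjoint pairs. -/
def Region.mk' (R : Fin k → Bool) (h : ∀ i j, ¬ (p i).Disj (R i) (p j) (R j)) : Region p :=
  ⟨R, fun i j => by
    by_cases hc : (p i).Commute (p j)
    · exact Or.inl hc
    · exact Or.inr (Set.nonempty_iff_ne_empty.2 fun h' => h i j ⟨hc, h'⟩)⟩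

theorem LabelCommute.symm {l l' : V ⊕ Fin k} (h : LabelCommute p l l') : LabelCommute p l' l := by
  cases l <;> cases l'
  · exact SimpleGraph.Adj.symm (G := Γ) h
  · exact h
  · exact h
  · exact ⟨h.1.symm, h.2.symm⟩

theorem labelCommute_inr {i j : Fin k} :
    LabelCommute p (Sum.inr i) (Sum.inr j) ↔ (p i).Commute (p j) :=
  ⟨fun h => h.2, fun h => ⟨fun h' => (p i).not_commute_self (by subst h'; exact h), h⟩⟩

theorem IsBlowupEdge.target_unique {R S S' : Region p} {l : (V ⊕ Fin k) × Bool}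
    (h : IsBlowupEdge p R S l) (h' : IsBlowupEdge p R S' l) : S = S' := by
  obtain ⟨l | l, b⟩ := l
  all_goals
    refine Region.ext fun i => ?_
    have h1 := (h.2 i).trans (h'.2 i).symm
    revert h1
    cases S.1 i <;> cases S'.1 i <;> cases R.1 i <;> simp

/-- If a label switches the side of `P_i`, then all labels commuting with it commute with `P_i`. -/
theorem IsBlowupEdge.commute_of_flip {R S : Region p} {l : (V ⊕ Fin k) × Bool}
    (h : IsBlowupEdge p R S l) {i : Fin k} (hi : S.1 i ≠ R.1 i) {l' : V ⊕ Fin k}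
    (hl : LabelCommute p l' l.1) : LabelCommute p l' (Sum.inr i) := by
  obtain ⟨v | j, b⟩ := l
  · obtain ⟨h1, h2⟩ := (h.2 i).1 hi
    have h2' : litInv (v, b) ∈ (p i).side (!R.1 i) :=
      mem_side_not.2 ⟨h2, litInv_notMem_link h1⟩
    cases l' with
    | inl w => exact adj_base_of_single h1 h2' (SimpleGraph.Adj.symm hl)
    | inr j =>
      exact labelCommute_inr.2
        (commute_iff.2 (adj_base_of_single h1 h2' (SimpleGraph.Adj.symm hl)).symm)
  · rw [(h.2 i).1 hi]
    exact hl

/-- An edge can be transported across partitions that commute with its label. -/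
theorem IsBlowupEdge.transport {R R' S S' : Region p} {l : (V ⊕ Fin k) × Bool}
    (h : IsBlowupEdge p R R' l) (hS : ∀ i, S.1 i ≠ R.1 i → LabelCommute p l.1 (Sum.inr i))
    (hS' : ∀ i, S'.1 i ≠ S.1 i ↔ R'.1 i ≠ R.1 i) : IsBlowupEdge p S S' l := by
  obtain ⟨v | j, b⟩ := l
  · refine ⟨fun i => ?_, fun i => ?_⟩
    · by_cases hi : S.1 i = R.1 i
      · rw [hi]; exact h.1 i
      · exact Or.inr (hS i hi)
    · rw [hS' i, h.2 i]
      by_cases hi : S.1 i = R.1 i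
      · rw [hi]
      · have hl : (v, b) ∈ (p i).link := hS i hi
        exact ⟨fun h' => absurd hl (notMem_link h'.1), fun h' => absurd hl (notMem_link h'.1)⟩
  · refine ⟨?_, fun i => (hS' i).trans (h.2 i)⟩
    by_contra hb
    refine labelCommute_irrefl p _ (hS j fun h' => hb (h'.trans h.1))

theorem BlowupCube.ext_of_vert_false {n : ℕ} {c d : BlowupCube p n}
    (hv : c.vert (fun _ => false) = d.vert (fun _ => false)) (hl : c.label = d.label) : c = d := by
  classical
  have key : ∀ s : Finset (Fin n), c.vert (fun i => decide (i ∈ s)) =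
      d.vert (fun i => decide (i ∈ s)) := by
    intro s
    induction s using Finset.induction_on with
    | empty => simpa using hv
    | insert a s ha ih =>
      have e0 : Function.update (fun i => decide (i ∈ s)) a false = fun i => decide (i ∈ s) := by
        funext i
        by_cases h : i = a
        · subst h; simp [ha]
        · simp [h]
      have e1 : Function.update (fun i => decide (i ∈ s)) a true =
          fun i => decide (i ∈ insert a s) := by
        funext i
        by_cases h : i = a
        · subst h; simp
        · simp [h]
      have hc := c.isEdge (fun i => decide (i ∈ s)) a
      have hd := d.isEdge (fun i => decide (i ∈ s)) a
      rw [e0, e1] at hc hd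
      rw [hl, ih] at hc
      exact hc.target_unique hd
  refine BlowupCube.ext (funext fun x => ?_) hl
  have := key (Finset.univ.filter fun i => x i = true)
  simpa using this

open Classical in
/-- Pairwise commuting labels of edges that start at one region span a cube. -/
theorem exists_cube {n : ℕ} {R : Region p} {l : Fin n → (V ⊕ Fin k) × Bool} {T : Fin n → Region p}
    (hT : ∀ j, IsBlowupEdge p R (T j) (l j))
    (hl : ∀ i j, i ≠ j → LabelCommute p (l i).1 (l j).1) :
    ∃ c : (blowup p).Cube n,
      BlowupCube.vert c (fun _ => false) = R ∧ BlowupCube.label c = l := by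
  let w : (Fin n → Bool) → Fin k → Bool := fun x i =>
    if ∃ j, x j = true ∧ (T j).1 i ≠ R.1 i then !(R.1 i) else R.1 i
  have w_pos : ∀ x i j, x j = true → (T j).1 i ≠ R.1 i → w x i = (T j).1 i := by
    intro x i j hx hj
    have : ∃ j, x j = true ∧ (T j).1 i ≠ R.1 i := ⟨j, hx, hj⟩
    simp only [w, if_pos this]
    revert hj
    cases (T j).1 i <;> cases R.1 i <;> simp
  have w_neg : ∀ x i, (¬ ∃ j, x j = true ∧ (T j).1 i ≠ R.1 i) → w x i = R.1 i := by
    intro x i h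
    simp only [w, if_neg h]
  have w_ne : ∀ x i, w x i ≠ R.1 i ↔ ∃ j, x j = true ∧ (T j).1 i ≠ R.1 i := by
    intro x i
    by_cases h : ∃ j, x j = true ∧ (T j).1 i ≠ R.1 i
    · simp only [w, if_pos h, h, iff_true]
      cases R.1 i <;> simp
    · simp [w_neg x i h, h]
  have key : ∀ i i' j j', (T j).1 i ≠ R.1 i → (T j').1 i' ≠ R.1 i' → j ≠ j' →
      LabelCommute p (Sum.inr i) (Sum.inr i') := by
    intro i i' j j' h h' hne
    exact (hT j').commute_of_flip h' ((hT j).commute_of_flip h (hl j' j hne.symm)).symm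
  have half : ∀ x i i', (∃ j, x j = true ∧ (T j).1 i ≠ R.1 i) →
      ¬ (p i).Disj (w x i) (p i') (w x i') := by
    rintro x i i' ⟨j, hx, hj⟩ hd
    rw [w_pos x i j hx hj] at hd
    by_cases h' : ∃ j, x j = true ∧ (T j).1 i' ≠ R.1 i'
    · obtain ⟨j', hx', hj'⟩ := h'
      by_cases hjj : j = j'
      · subst hjj
        rw [w_pos x i' j hx' hj'] at hd
        exact (T j).not_disj _ _ hd
      · exact hd.1 (labelCommute_inr.1 (key i i' j j' hj hj' hjj))
    · have : w x i' = (T j).1 i' := by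
        rw [w_neg x i' h']
        by_contra hne
        exact h' ⟨j, hx, fun h => hne h.symm⟩
      rw [this] at hd
      exact (T j).not_disj _ _ hd
  let vert : (Fin n → Bool) → Region p := fun x => Region.mk' (w x) fun i i' hd => by
    by_cases h : ∃ j, x j = true ∧ (T j).1 i ≠ R.1 i
    · exact half x i i' h hd
    by_cases h' : ∃ j, x j = true ∧ (T j).1 i' ≠ R.1 i'
    · exact half x i' i h' hd.symm
    rw [w_neg x i h, w_neg x i' h'] at hd
    exact R.not_disj _ _ hd
  refine ⟨BlowupCube.mk vert l hl fun x a => ?_, ?_, rfl⟩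
  · refine (hT a).transport (fun i hi => ?_) (fun i => ?_)
    · obtain ⟨j, hx, hj⟩ := (w_ne _ i).1 hi
      have hja : j ≠ a := by rintro rfl; simp at hx
      exact (hT j).commute_of_flip hj (hl a j hja.symm)
    · change w _ i ≠ w _ i ↔ _
      by_cases ha : (T a).1 i ≠ R.1 i
      · have h0 : ¬ ∃ j, Function.update x a false j = true ∧ (T j).1 i ≠ R.1 i := by
          rintro ⟨j, hx, hj⟩
          have hja : j ≠ a := by rintro rfl; simp at hx
          exact labelCommute_irrefl p _ (key i i j a hj ha hja)
        rw [w_pos _ i a (by simp) ha, w_neg _ i h0]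
      · have : (∃ j, Function.update x a true j = true ∧ (T j).1 i ≠ R.1 i) ↔
            ∃ j, Function.update x a false j = true ∧ (T j).1 i ≠ R.1 i := by
          refine exists_congr fun j => ?_
          by_cases hja : j = a
          · subst hja; simp [ha]
          · simp [hja]
        simp only [w, this, ne_eq, not_true_eq_false, false_iff]
        exact fun h => ha h
  · refine Region.ext fun i => ?_
    exact w_neg _ i (by simp)

/-- The label of an oriented edge. -/
def edgeLabel (e : (blowup p).Cube 1) : (V ⊕ Fin k) × Bool := BlowupCube.label e 0

/-- The initial region of an oriented edge. -/
def edgeSource (e : (blowup p).Cube 1) : Region p := BlowupCube.vert e fun _ => false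

/-- The terminal region of an oriented edge. -/
def edgeTarget (e : (blowup p).Cube 1) : Region p := BlowupCube.vert e fun _ => true

theorem isBlowupEdge_edge (e : (blowup p).Cube 1) :
    IsBlowupEdge p (edgeSource e) (edgeTarget e) (edgeLabel e) := by
  have h := BlowupCube.isEdge e (fun _ => false) 0
  have e0 : Function.update (fun _ : Fin 1 => false) 0 false = fun _ => false := by
    funext i; simp [Subsingleton.elim i 0]
  have e1 : Function.update (fun _ : Fin 1 => false) 0 true = fun _ => true := by
    funext i; simp [Subsingleton.elim i 0]
  rwa [e0, e1] at h

theorem edge_ext {e e' : (blowup p).Cube 1} (hs : edgeSource e = edgeSource e')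
    (hl : edgeLabel e = edgeLabel e') : e = e' :=
  BlowupCube.ext_of_vert_false hs (funext fun i => by rw [Subsingleton.elim i 0]; exact hl)

theorem exists_edge {R S : Region p} {l : (V ⊕ Fin k) × Bool} (h : IsBlowupEdge p R S l) :
    ∃ e : (blowup p).Cube 1, edgeSource e = R ∧ edgeTarget e = S ∧ edgeLabel e = l := by
  obtain ⟨c, h1, h2⟩ := exists_cube (n := 1) (T := fun _ => S) (l := fun _ => l) (fun _ => h)
    (fun i j hne => absurd (Subsingleton.elim i j) hne)
  have h3 : edgeLabel c = l := congrFun h2 0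
  have h4 := isBlowupEdge_edge c
  rw [h3, show edgeSource c = R from h1] at h4
  exact ⟨c, h1, h4.target_unique h, h3⟩

/-- The vertex of the blow-up given by a region. -/
def regionVertex (R : Region p) : (blowup p).Cube 0 := BlowupCube.mk (p := p)
  (fun _ => R) Fin.elim0 (fun i => i.elim0) fun _ i => i.elim0

/-- The region that is a given vertex of the blow-up. -/
def vertexRegion (c : (blowup p).Cube 0) : Region p := BlowupCube.vert c fun _ => false

theorem regionVertex_vertexRegion (c : (blowup p).Cube 0) : regionVertex (vertexRegion c) = c :=
  BlowupCube.ext_of_vert_false rfl (funext fun i => i.elim0)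

theorem vertexRegion_regionVertex (R : Region p) : vertexRegion (regionVertex R) = R := rfl

theorem regionVertex_injective : Function.Injective (regionVertex (p := p)) :=
  fun R S h => by rw [← vertexRegion_regionVertex R, h, vertexRegion_regionVertex]

theorem vertexOf_eq {n : ℕ} (c : (blowup p).Cube n) (x : Fin n → Bool) :
    (blowup p).vertexOf c x = regionVertex (BlowupCube.vert c x) := by
  refine BlowupCube.ext_of_vert_false ?_ (funext fun i => i.elim0)
  change BlowupCube.vert c _ = BlowupCube.vert c x
  congr 1
  funext i
  simp [CubeMap.onVertex, CubeMap.vertex]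

theorem source_eq (e : (blowup p).Cube 1) :
    (blowup p).source e = regionVertex (edgeSource e) := vertexOf_eq _ _

theorem target_eq (e : (blowup p).Cube 1) :
    (blowup p).target e = regionVertex (edgeTarget e) := vertexOf_eq _ _

theorem edgeSource_edgeOf {n : ℕ} (c : (blowup p).Cube n) (i : Fin n) (x : Fin n → Bool) :
    edgeSource ((blowup p).edgeOf c i x) = BlowupCube.vert c x := by
  change BlowupCube.vert c _ = BlowupCube.vert c x
  congr 1
  funext i
  simp [CubeMap.onVertex, CubeMap.edge]

theorem edgeLabel_edgeOf {n : ℕ} (c : (blowup p).Cube n) (i : Fin n) (x : Fin n → Bool) :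
    edgeLabel ((blowup p).edgeOf c i x) =
      ((BlowupCube.label c i).1, xor (x i) (BlowupCube.label c i).2) := rfl

theorem edgeLabel_rev (e : (blowup p).Cube 1) :
    edgeLabel ((blowup p).rev e) = ((edgeLabel e).1, !(edgeLabel e).2) := by
  rw [CubeComplex.rev, edgeLabel_edgeOf, Bool.true_xor]
  rfl

theorem edgeSource_rev (e : (blowup p).Cube 1) :
    edgeSource ((blowup p).rev e) = edgeTarget e := edgeSource_edgeOf _ _ _

/-- Two edges that start at one region and carry commuting labels span a square. -/
theorem spanSquare_of_commute {e e' : (blowup p).Cube 1} (hs : edgeSource e = edgeSource e')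
    (hl : LabelCommute p (edgeLabel e).1 (edgeLabel e').1) : (blowup p).SpanSquare e e' := by
  obtain ⟨c, h1, h2⟩ := exists_cube (n := 2) (R := edgeSource e)
    (T := ![edgeTarget e, edgeTarget e']) (l := ![edgeLabel e, edgeLabel e'])
    (by
      intro j
      fin_cases j
      · exact isBlowupEdge_edge e
      · simpa [hs] using isBlowupEdge_edge e')
    (by
      intro i j hij
      fin_cases i <;> fin_cases j
      · exact absurd rfl hij
      · exact hl
      · exact hl.symm
      · exact absurd rfl hij)
  have hv : ![false, false] = fun _ : Fin 2 => false := by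
    funext i; fin_cases i <;> rfl
  refine ⟨c, edge_ext ?_ ?_, edge_ext ?_ ?_⟩
  · exact (edgeSource_edgeOf c 0 ![false, false]).trans (by rw [hv, h1])
  · exact (edgeLabel_edgeOf c 0 ![false, false]).trans (by rw [h2]; simp)
  · exact (edgeSource_edgeOf c 1 ![false, false]).trans (by rw [hv, h1, hs])
  · exact (edgeLabel_edgeOf c 1 ![false, false]).trans (by rw [h2]; simp)

theorem labelCommute_of_square (s : (blowup p).Cube 2) :
    LabelCommute p (edgeLabel ((blowup p).bottom s)).1 (edgeLabel ((blowup p).left s)).1 :=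
  BlowupCube.commute s 0 1 (by decide)

theorem edgeLabel_top (s : (blowup p).Cube 2) :
    edgeLabel ((blowup p).top s) = edgeLabel ((blowup p).bottom s) := rfl

end BlowupCubes

/-! ### Existence and connectedness of regions -/

section Regions

open WhiteheadPartition

variable {V : Type u} {Γ : SimpleGraph V} {k : ℕ} {p : Fin k → WhiteheadPartition Γ}

/-- A choice of sides for some of the partitions without disjoint pairs extends to a region: by
transitivity, for each further partition at most one of its sides is excluded. -/
theorem WhiteheadPartition.IsCompatibleCollection.exists_region (hp : IsCompatibleCollection p)
    (T : Set (Fin k))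
    (a : Fin k → Bool) (h : ∀ i ∈ T, ∀ j ∈ T, ¬ (p i).Disj (a i) (p j) (a j)) :
    ∃ R : Region p, ∀ i ∈ T, R.1 i = a i := by
  classical
  have key : ∀ s : Finset (Fin k), ∃ a' : Fin k → Bool, (∀ i ∈ T, a' i = a i) ∧
      ∀ i, i ∈ T ∨ i ∈ s → ∀ j, j ∈ T ∨ j ∈ s → ¬ (p i).Disj (a' i) (p j) (a' j) := by
    intro s
    induction s using Finset.induction_on with
    | empty =>
      refine ⟨a, fun _ _ => rfl, fun i hi j hj => ?_⟩
      exact h i (by simpa using hi) j (by simpa using hj)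
    | insert l s hl ih =>
      obtain ⟨a', h1, h2⟩ := ih
      by_cases hlT : l ∈ T
      · refine ⟨a', h1, fun i hi j hj => h2 i ?_ j ?_⟩
        · rcases hi with hi | hi
          · exact Or.inl hi
          · rcases Finset.mem_insert.1 hi with rfl | hi
            · exact Or.inl hlT
            · exact Or.inr hi
        · rcases hj with hj | hj
          · exact Or.inl hj
          · rcases Finset.mem_insert.1 hj with rfl | hj
            · exact Or.inl hlT
            · exact Or.inr hj
      · obtain ⟨b, hb⟩ : ∃ b, ∀ i, i ∈ T ∨ i ∈ s → ¬ (p i).Disj (a' i) (p l) b := by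
          by_contra hcon
          push Not at hcon
          obtain ⟨i, hi, hd⟩ := hcon true
          obtain ⟨j, hj, hd'⟩ := hcon false
          exact h2 i hi j hj (hp.disj_trans hd hd'.symm)
        refine ⟨Function.update a' l b, fun i hi => ?_, fun i hi j hj => ?_⟩
        · rw [Function.update_of_ne (by rintro rfl; exact hlT hi), h1 i hi]
        · have hs : ∀ i, i ∈ T ∨ i ∈ insert l s → i ≠ l → i ∈ T ∨ i ∈ s := by
            intro i hi hne
            rcases hi with hi | hi
            · exact Or.inl hi
            · exact Or.inr ((Finset.mem_insert.1 hi).resolve_left hne)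
          by_cases hil : i = l <;> by_cases hjl : j = l
          · subst hil; subst hjl
            rw [Function.update_self, disj_self]
            cases b <;> simp
          · subst hil
            rw [Function.update_self, Function.update_of_ne hjl]
            exact fun hd => hb j (hs j hj hjl) hd.symm
          · subst hjl
            rw [Function.update_self, Function.update_of_ne hil]
            exact hb i (hs i hi hil)
          · rw [Function.update_of_ne hil, Function.update_of_ne hjl]
            exact h2 i (hs i hi hil) j (hs j hj hjl)
  obtain ⟨a', h1, h2⟩ := key Finset.univ
  exact ⟨Region.mk' a' fun i j => h2 i (by simp) j (by simp), h1⟩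

theorem WhiteheadPartition.IsCompatibleCollection.exists_region_eq (hp : IsCompatibleCollection p)
    (i : Fin k)
    (b : Bool) : ∃ R : Region p, R.1 i = b := by
  obtain ⟨R, hR⟩ := hp.exists_region {i} (fun _ => b) (by
    rintro i rfl j rfl
    rw [disj_self]
    cases b <;> simp)
  exact ⟨R, hR i rfl⟩

theorem eq_of_mem_regionLits {R : Region p} {x : V × Bool} (h : x ∈ regionLits p R) {i : Fin k}
    {b : Bool} (hx : x ∈ (p i).side b) : R.1 i = b :=
  eq_of_mem_side ((h i).resolve_right (notMem_link hx)) hx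

/-- The sides that contain a literal, together with either side of one partition that has it in its
link, extend to a region. -/
theorem WhiteheadPartition.IsCompatibleCollection.exists_regionLits_of_link
    (hp : IsCompatibleCollection p)
    (x : V × Bool) (l : Fin k) (hl : x ∈ (p l).link) (b : Bool) :
    ∃ R : Region p, x ∈ regionLits p R ∧ R.1 l = b := by
  classical
  have hex : ∀ i, ∃ c, (x ∈ (p i).link ∨ x ∈ (p i).side c) ∧ (x ∈ (p i).link → c = b) := by
    intro i
    by_cases hi : x ∈ (p i).link
    · exact ⟨b, Or.inl hi, fun _ => rfl⟩
    · obtain ⟨c, hc⟩ := exists_mem_side hi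
      exact ⟨c, Or.inr hc, fun h => absurd h hi⟩
  choose a ha hab using hex
  have key : ∀ j, x ∉ (p j).link → ¬ (p j).Disj (a j) (p l) (a l) := by
    intro j hj hd
    have hx := (ha j).resolve_left hj
    have h1 := mem_side_of_adj hx (v := (p l).base.1) (SimpleGraph.Adj.symm hl)
      (fun h => hd.1 (commute_iff.2 h)) ((p l).sideBase (a l)).2
    exact hd.notMem h1 ((p l).sideBase_mem (a l))
  obtain ⟨R, hR⟩ := hp.exists_region {j | x ∉ (p j).link ∨ j = l} a (by
    rintro i (hi | rfl) j (hj | rfl) hd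
    · exact hd.notMem ((ha i).resolve_left hi) ((ha j).resolve_left hj)
    · exact key i hi hd
    · exact key j hj hd.symm
    · exact absurd (disj_self.1 hd) (by simp))
  refine ⟨R, fun i => ?_, ?_⟩
  · by_cases hi : x ∈ (p i).link
    · exact Or.inr hi
    · rw [hR i (Or.inl hi)]
      exact Or.inl ((ha i).resolve_left hi)
  · rw [hR l (Or.inr rfl), hab l hl]

theorem WhiteheadPartition.IsCompatibleCollection.exists_regionLits (hp : IsCompatibleCollection p)
    (x : V × Bool) : ∃ R : Region p, x ∈ regionLits p R := by
  by_cases hl : ∃ l, x ∈ (p l).link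
  · obtain ⟨l, hl⟩ := hl
    obtain ⟨R, hR, -⟩ := hp.exists_regionLits_of_link x l hl false
    exact ⟨R, hR⟩
  · push Not at hl
    choose a ha using fun i => exists_mem_side (hl i)
    exact ⟨Region.mk' a fun i j hd => hd.notMem (ha i) (ha j), fun i => Or.inl (ha i)⟩

/-- Every literal of `I(R)` labels an edge that starts at `R`. -/
theorem exists_generator_edge {R : Region p} {v : V} {b : Bool} (h : (v, b) ∈ regionLits p R) :
    ∃ S, IsBlowupEdge p R S (Sum.inl v, b) := by
  classical
  let w : Fin k → Bool := fun i =>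
    if (v, b) ∈ (p i).side (R.1 i) ∧ litInv (v, b) ∉ (p i).side (R.1 i) then !R.1 i else R.1 i
  have w_mem : ∀ i, (v, b) ∉ (p i).link → litInv (v, b) ∈ (p i).side (w i) := by
    intro i hi
    have hx := (h i).resolve_right hi
    by_cases hw : litInv (v, b) ∈ (p i).side (R.1 i)
    · simp only [w, hw, not_true_eq_false, and_false, if_false]
    · simp only [w, if_pos (And.intro hx hw)]
      exact mem_side_not.2 ⟨hw, hi⟩
  have w_link : ∀ i, (v, b) ∈ (p i).link → w i = R.1 i := by
    intro i hi
    exact if_neg fun h' => notMem_link h'.1 hi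
  have mixed : ∀ i j, (v, b) ∉ (p i).link → (v, b) ∈ (p j).link →
      ¬ (p i).Disj (w i) (p j) (w j) := by
    intro i j hi hj hd
    rw [w_link j hj] at hd
    by_cases hw : litInv (v, b) ∈ (p i).side (R.1 i)
    · simp only [w, hw, not_true_eq_false, and_false, if_false] at hd
      exact R.not_disj _ _ hd
    · exact hd.1 (commute_iff.2 (adj_base_of_single ((h i).resolve_right hi)
        (mem_side_not.2 ⟨hw, hi⟩) (SimpleGraph.Adj.symm hj)))
  refine ⟨Region.mk' w fun i j hd => ?_, h, fun i => ?_⟩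
  · by_cases hi : (v, b) ∈ (p i).link <;> by_cases hj : (v, b) ∈ (p j).link
    · rw [w_link i hi, w_link j hj] at hd
      exact R.not_disj _ _ hd
    · exact mixed j i hj hi hd.symm
    · exact mixed i j hi hj hd
    · exact hd.notMem (w_mem i hi) (w_mem j hj)
  · change w i ≠ R.1 i ↔ _
    by_cases hw : (v, b) ∈ (p i).side (R.1 i) ∧ litInv (v, b) ∉ (p i).side (R.1 i)
    · simp only [w, if_pos hw, hw]
      cases R.1 i <;> simp
    · simp only [w, if_neg hw, ne_eq, not_true_eq_false, hw]

/-- Two different regions are joined by a shortest path: some side in which they differ can be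
switched.  One switches a side that is minimal among those in which the regions differ. -/
theorem WhiteheadPartition.IsCompatibleCollection.exists_flip (hp : IsCompatibleCollection p)
    {R R' : Region p}
    (h : R ≠ R') : ∃ (i : Fin k) (S : Region p), R.1 i ≠ R'.1 i ∧ ∀ j, S.1 j ≠ R.1 j ↔ j = i := by
  classical
  let r : Fin k → Fin k → Prop := fun j i => j ≠ i ∧ (p j).Disj (R.1 j) (p i) (!R.1 i)
  have : Std.Irrefl r := ⟨fun i h => h.1 rfl⟩
  have : IsTrans (Fin k) r := ⟨by
    rintro a b c ⟨h1, h2⟩ ⟨h3, h4⟩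
    refine ⟨?_, hp.disj_trans h2 (by simpa using h4)⟩
    rintro rfl
    exact h1 (hp.eq_of_disj h2 (by simpa using h4.symm))⟩
  have wf : WellFounded r := Finite.wellFounded_of_trans_of_irrefl r
  have hne : {i | R.1 i ≠ R'.1 i}.Nonempty := by
    by_contra hcon
    refine h (Region.ext fun i => ?_)
    by_contra hi
    exact hcon ⟨i, hi⟩
  obtain ⟨i, hi, hmin⟩ := wf.has_min _ hne
  have key : ∀ j, j ≠ i → ¬ (p j).Disj (R.1 j) (p i) (!R.1 i) := by
    intro j hj hd
    by_cases hjD : R.1 j = R'.1 j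
    · rw [hjD, ← Bool.eq_not.2 (Ne.symm hi)] at hd
      exact R'.not_disj _ _ hd
    · exact hmin j hjD ⟨hj, hd⟩
  refine ⟨i, Region.mk' (Function.update R.1 i (!R.1 i)) fun j l => ?_, hi, fun j => ?_⟩
  · by_cases hji : j = i <;> by_cases hli : l = i
    · subst hji; subst hli
      rw [disj_self, Function.update_self]
      cases R.1 l <;> simp
    · subst hji
      rw [Function.update_self, Function.update_of_ne hli, disj_comm]
      exact key l hli
    · subst hli
      rw [Function.update_self, Function.update_of_ne hji]
      exact key j hji
    · rw [Function.update_of_ne hji, Function.update_of_ne hli]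
      exact R.not_disj _ _
  · change Function.update R.1 i (!R.1 i) j ≠ R.1 j ↔ j = i
    by_cases hji : j = i
    · subst hji
      rw [Function.update_self]
      cases R.1 j <;> simp
    · simp [hji]

/-- Induction along shortest paths towards the region `R'`. -/
theorem WhiteheadPartition.IsCompatibleCollection.induction_toward (hp : IsCompatibleCollection p)
    (R' : Region p)
    {motive : Region p → Prop} (base : motive R')
    (step : ∀ (R S : Region p) (i : Fin k), R.1 i ≠ R'.1 i → (∀ j, S.1 j ≠ R.1 j ↔ j = i) →
      motive S → motive R) (R : Region p) : motive R := by
  classical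
  induction hn : (Finset.univ.filter fun i => R.1 i ≠ R'.1 i).card using Nat.strong_induction_on
    generalizing R with
  | _ n ih =>
    by_cases h : R = R'
    · exact h ▸ base
    · obtain ⟨i, S, hi, hS⟩ := hp.exists_flip h
      refine step R S i hi hS (ih _ ?_ S rfl)
      rw [← hn]
      refine Finset.card_lt_card (Finset.ssubset_iff_subset_ne.2 ⟨fun j hj => ?_, fun he => ?_⟩)
      · simp only [Finset.mem_filter, Finset.mem_univ, true_and] at hj ⊢
        by_cases hji : j = i
        · rwa [hji]
        · have : S.1 j = R.1 j := by
            by_contra h'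
            exact hji ((hS j).1 h')
          rwa [← this]
      · have h1 : i ∈ Finset.univ.filter fun i => R.1 i ≠ R'.1 i := by simpa using hi
        rw [← he] at h1
        have h2 : S.1 i ≠ R'.1 i := by simpa using h1
        have h3 := (hS i).2 rfl
        revert hi h2 h3
        cases S.1 i <;> cases R.1 i <;> cases R'.1 i <;> simp

theorem isBlowupEdge_of_flip {R S : Region p} {i : Fin k} (h : ∀ j, S.1 j ≠ R.1 j ↔ j = i) :
    IsBlowupEdge p R S (Sum.inr i, R.1 i) := ⟨rfl, h⟩

theorem eq_of_flip {R S : Region p} {i : Fin k} (h : ∀ j, S.1 j ≠ R.1 j ↔ j = i) {j : Fin k}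
    (hj : j ≠ i) : S.1 j = R.1 j := by
  by_contra h'
  exact hj ((h j).1 h')

theorem eq_not_of_flip {R S : Region p} {i : Fin k} (h : ∀ j, S.1 j ≠ R.1 j ↔ j = i) :
    S.1 i = !R.1 i := Bool.eq_not.2 ((h i).2 rfl)

theorem WhiteheadPartition.IsCompatibleCollection.exists_partition_edge
    (hp : IsCompatibleCollection p) (i : Fin k)
    (b : Bool) : ∃ R S, IsBlowupEdge p R S (Sum.inr i, b) := by
  obtain ⟨R₁, h₁⟩ := hp.exists_region_eq i (!b)
  obtain ⟨R₀, h₀⟩ := hp.exists_region_eq i b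
  revert h₀
  refine hp.induction_toward R₁ (motive := fun R => R.1 i = b → _) ?_ ?_ R₀
  · intro h
    rw [h₁] at h
    revert h; cases b <;> simp
  · intro R S j hj hS ih hR
    by_cases hji : i = j
    · subst hji
      exact ⟨R, S, hR, hS⟩
    · exact ih ((eq_of_flip hS hji).trans hR)

/-- Every label is the label of an edge. -/
theorem WhiteheadPartition.IsCompatibleCollection.exists_edgeLabel (hp : IsCompatibleCollection p)
    (l : (V ⊕ Fin k) × Bool) : ∃ e : (blowup p).Cube 1, edgeLabel e = l := by
  have : ∃ R S, IsBlowupEdge p R S l := by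
    obtain ⟨v | i, b⟩ := l
    · obtain ⟨R, hR⟩ := hp.exists_regionLits (v, b)
      exact ⟨R, exists_generator_edge hR⟩
    · exact hp.exists_partition_edge i b
  obtain ⟨R, S, h⟩ := this
  obtain ⟨e, -, -, he⟩ := exists_edge h
  exact ⟨e, he⟩

/-! ### Hyperplanes are labels -/

/-- The initial regions of two edges with one label differ only in partitions that commute with the
label. -/
theorem WhiteheadPartition.IsCompatibleCollection.commute_of_ne (hp : IsCompatibleCollection p)
    {R S R' S' : Region p}
    {l : (V ⊕ Fin k) × Bool} (h : IsBlowupEdge p R S l) (h' : IsBlowupEdge p R' S' l) {i : Fin k}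
    (hi : R.1 i ≠ R'.1 i) : LabelCommute p l.1 (Sum.inr i) := by
  obtain ⟨v | j, b⟩ := l
  · by_contra hl
    have h1 := (h.1 i).resolve_right hl
    have h2 := (h'.1 i).resolve_right hl
    exact hi (eq_of_mem_side h1 h2)
  · have hij : i ≠ j := by
      rintro rfl
      exact hi (h.1.trans h'.1.symm)
    rw [labelCommute_inr]
    by_contra hc
    obtain ⟨c, a, hd⟩ := hp.exists_disj hij.symm hc
    -- the edge visits both sides of `p j`, which leaves only one side of `p i`
    have key : ∀ {R S : Region p}, IsBlowupEdge p R S (Sum.inr j, b) → R.1 i ≠ a := by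
      intro R S h ha
      have hS : S.1 i = a := (eq_of_flip h.2 hij).trans ha
      by_cases hc : R.1 j = c
      · exact R.not_disj j i (by rw [hc, ha]; exact hd)
      · refine S.not_disj j i ?_
        rw [hS, eq_not_of_flip h.2, Bool.eq_not.2 hc, Bool.not_not]
        exact hd
    have h1 := key h
    have h2 := key h'
    revert hi h1 h2
    cases R.1 i <;> cases R'.1 i <;> cases a <;> simp

theorem edgeTarget_edgeOf {n : ℕ} (c : (blowup p).Cube n) (i : Fin n) (x : Fin n → Bool) :
    edgeTarget ((blowup p).edgeOf c i x) =
      BlowupCube.vert c (Function.update x i (!x i)) := by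
  change BlowupCube.vert c _ = BlowupCube.vert c _
  congr 1
  funext j
  by_cases h : j = i
  · subst h
    simp only [CubeMap.onVertex, CubeMap.edge, Function.update_self]
    simp [DFunLike.coe]
  · have h' : ¬ i = j := Ne.symm h
    simp only [CubeMap.onVertex, CubeMap.edge, Function.update_of_ne h]
    simp [DFunLike.coe, h']

theorem edgeSource_top (s : (blowup p).Cube 2) :
    edgeSource ((blowup p).top s) = edgeTarget ((blowup p).left s) := by
  refine (edgeSource_edgeOf s 0 ![false, true]).trans
    (Eq.trans ?_ (edgeTarget_edgeOf s 1 ![false, false]).symm)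
  congr 1
  funext j
  fin_cases j <;> rfl

theorem edgeLabel_eq_of_parallel {e e' : (blowup p).Cube 1} (h : (blowup p).Parallel e e') :
    edgeLabel e = edgeLabel e' := by
  induction h with
  | rel a b hab =>
    obtain ⟨s, rfl, rfl⟩ := hab
    rfl
  | refl => rfl
  | symm _ _ _ ih => exact ih.symm
  | trans _ _ _ _ _ ih ih' => exact ih.trans ih'

/-- Edges with the same label are parallel: along a shortest path between their initial regions,
each step spans a square with the edge. -/
theorem WhiteheadPartition.IsCompatibleCollection.parallel_iff (hp : IsCompatibleCollection p)
    {e e' : (blowup p).Cube 1} : (blowup p).Parallel e e' ↔ edgeLabel e = edgeLabel e' := by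
  refine ⟨edgeLabel_eq_of_parallel, fun h => ?_⟩
  suffices H : ∀ R : Region p, ∀ e, edgeSource e = R → edgeLabel e = edgeLabel e' →
      (blowup p).Parallel e e' from H _ e rfl h
  intro R
  refine hp.induction_toward (edgeSource e')
    (motive := fun R => ∀ e, edgeSource e = R → edgeLabel e = edgeLabel e' →
      (blowup p).Parallel e e') ?_ ?_ R
  · intro e hs hl
    rw [edge_ext hs hl]
    exact Relation.EqvGen.refl _
  · rintro R S i hi hS ih e rfl hl
    have h1 := isBlowupEdge_edge e
    have hc : LabelCommute p (edgeLabel e).1 (Sum.inr i) :=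
      hp.commute_of_ne h1 (by rw [hl]; exact isBlowupEdge_edge e') hi
    obtain ⟨g, hg1, hg2, hg3⟩ := exists_edge (isBlowupEdge_of_flip hS)
    obtain ⟨s, hs1, hs2⟩ := spanSquare_of_commute (e := e) (e' := g) hg1.symm
      (by rw [hg3]; exact hc)
    have h2 := ih ((blowup p).top s) (by rw [edgeSource_top, hs2, hg2])
      (by rw [edgeLabel_top, hs1, hl])
    exact Relation.EqvGen.trans _ _ _ (Relation.EqvGen.rel _ _ ⟨s, hs1, rfl⟩) h2

/-- The label of a hyperplane: that of its dual edges, without the orientation. -/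
def hyperplaneLabel : (blowup p).Hyperplane → V ⊕ Fin k :=
  Quot.lift (fun e => (edgeLabel e).1) (by
    rintro e e' (⟨s, rfl, rfl⟩ | rfl)
    · rfl
    · rw [edgeLabel_rev])

theorem hyperplaneLabel_dual (e : (blowup p).Cube 1) :
    hyperplaneLabel ((blowup p).dual e) = (edgeLabel e).1 := rfl

theorem CubeComplex.dual_rev (X : CubeComplex.{u}) (e : X.Cube 1) : X.dual (X.rev e) = X.dual e :=
  Eq.symm (Quot.sound (r := fun e e' : X.Cube 1 =>
    (∃ s : X.Cube 2, X.bottom s = e ∧ X.top s = e') ∨ X.rev e = e') (Or.inr rfl))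

theorem CubeComplex.dual_eq_of_parallel (X : CubeComplex.{u}) {e e' : X.Cube 1}
    (h : X.Parallel e e') : X.dual e = X.dual e' := by
  induction h with
  | rel a b hab => exact Quot.sound (Or.inl hab)
  | refl => rfl
  | symm _ _ _ ih => exact ih.symm
  | trans _ _ _ _ _ ih ih' => exact ih.trans ih'

theorem WhiteheadPartition.IsCompatibleCollection.dual_eq (hp : IsCompatibleCollection p)
    {e e' : (blowup p).Cube 1}
    (h : (edgeLabel e).1 = (edgeLabel e').1) : (blowup p).dual e = (blowup p).dual e' := by
  by_cases hb : (edgeLabel e).2 = (edgeLabel e').2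
  · exact CubeComplex.dual_eq_of_parallel _ (hp.parallel_iff.2 (Prod.ext h hb))
  · rw [← CubeComplex.dual_rev _ e']
    refine CubeComplex.dual_eq_of_parallel _ (hp.parallel_iff.2 ?_)
    rw [edgeLabel_rev]
    exact Prod.ext h (Bool.eq_not.2 hb)

theorem WhiteheadPartition.IsCompatibleCollection.hyperplaneLabel_injective
    (hp : IsCompatibleCollection p) :
    Function.Injective (hyperplaneLabel (p := p)) := by
  intro K L h
  obtain ⟨e, rfl⟩ := Quot.exists_rep K
  obtain ⟨e', rfl⟩ := Quot.exists_rep L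
  exact hp.dual_eq h

theorem WhiteheadPartition.IsCompatibleCollection.exists_hyperplaneLabel
    (hp : IsCompatibleCollection p)
    (l : V ⊕ Fin k) : ∃ K, hyperplaneLabel (p := p) K = l := by
  obtain ⟨e, he⟩ := hp.exists_edgeLabel (l, false)
  exact ⟨(blowup p).dual e, by rw [hyperplaneLabel_dual, he]⟩

theorem labelCommute_of_cross {K L : (blowup p).Hyperplane} (h : (blowup p).Cross K L) :
    LabelCommute p (hyperplaneLabel K) (hyperplaneLabel L) := by
  obtain ⟨s, rfl, rfl⟩ := h
  exact labelCommute_of_square s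

end Regions

section Special

open WhiteheadPartition

variable {V : Type u} {Γ : SimpleGraph V} {k : ℕ} {p : Fin k → WhiteheadPartition Γ}

/-! ### The blow-up is compact and special -/

instance : Finite (Region p) := inferInstanceAs (Finite (Subtype _))

theorem isCompact_blowup [Finite V] : (blowup p).IsCompact := by
  refine ⟨fun n => ?_, Nat.card (V ⊕ Fin k), fun n hn => ⟨fun c => ?_⟩⟩
  · exact Finite.of_injective
      (fun c : BlowupCube p n => (c.vert (fun _ => false), c.label))
      fun c d h => BlowupCube.ext_of_vert_false (congrArg Prod.fst h) (congrArg Prod.snd h)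
  · have hinj : Function.Injective fun i => (BlowupCube.label c i).1 := by
      intro i j hij
      by_contra hne
      have := BlowupCube.commute c i j hne
      rw [show (BlowupCube.label c i).1 = (BlowupCube.label c j).1 from hij] at this
      exact labelCommute_irrefl p _ this
    have := Nat.card_le_card_of_injective _ hinj
    rw [Nat.card_eq_fintype_card, Fintype.card_fin] at this
    omega

theorem edgeSource_eq_of_source_eq {e : (blowup p).Cube 1} {x : (blowup p).Cube 0}
    (h : (blowup p).source e = x) : edgeSource e = vertexRegion x := by
  rw [← h, source_eq, vertexRegion_regionVertex]

theorem isNPC_blowup : (blowup p).IsNPC := by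
  refine ⟨fun s h => ?_, fun n x e hs hsq => ?_⟩
  · have := labelCommute_of_square s
    rw [h] at this
    exact labelCommute_irrefl p _ this
  · have hx := fun i => edgeSource_eq_of_source_eq (hs i)
    obtain ⟨c, hc, hl⟩ := exists_cube (R := vertexRegion x) (l := fun i => edgeLabel (e i))
      (T := fun i => edgeTarget (e i)) (fun i => by rw [← hx i]; exact isBlowupEdge_edge (e i))
      (by
        intro i j hij
        obtain ⟨s, hs1, hs2⟩ := hsq i j hij
        rw [← hs1, ← hs2]
        exact labelCommute_of_square s)
    refine ⟨c, ⟨?_, fun i => edge_ext ?_ ?_⟩, fun d ⟨hd, hd'⟩ => ?_⟩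
    · rw [vertexOf_eq, hc, regionVertex_vertexRegion]
    · rw [edgeSource_edgeOf, hc, hx i]
    · rw [edgeLabel_edgeOf, hl]; simp
    · refine BlowupCube.ext_of_vert_false ?_ (funext fun i => ?_)
      · rw [vertexOf_eq] at hd
        rw [hc, ← hd, vertexRegion_regionVertex]
      · rw [hl]
        change _ = edgeLabel (e i)
        rw [← hd' i, edgeLabel_edgeOf]
        simp

theorem isSpecial_blowup : (blowup p).IsSpecial where
  npc := isNPC_blowup
  two_sided e h := by
    have := congrArg Prod.snd (edgeLabel_eq_of_parallel h)
    rw [edgeLabel_rev] at this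
    simp at this
  embedded K h := labelCommute_irrefl p _ (labelCommute_of_cross h)
  no_self_osculation e e' h hs := by
    rw [source_eq, source_eq] at hs
    exact edge_ext (regionVertex_injective hs) (edgeLabel_eq_of_parallel h)
  no_inter_osculation e e' h hs := by
    rw [source_eq, source_eq] at hs
    exact spanSquare_of_commute (regionVertex_injective hs) (labelCommute_of_cross h)

/-! ### Automorphisms that preserve all labels -/

/-- The action of an automorphism on regions. -/
def autoRegion (f : (blowup p).Auto) (R : Region p) : Region p :=
  vertexRegion (f.map 0 (regionVertex R))

theorem edgeSource_map (f : (blowup p).Auto) (e : (blowup p).Cube 1) :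
    edgeSource (f.map 1 e) = autoRegion f (edgeSource e) := by
  have h : (blowup p).source (f.map 1 e) = f.map 0 ((blowup p).source e) :=
    (f.map_restrict _ _).symm
  rw [edgeSource_eq_of_source_eq h, source_eq, autoRegion]

theorem map_rev (f : (blowup p).Auto) (e : (blowup p).Cube 1) :
    f.map 1 ((blowup p).rev e) = (blowup p).rev (f.map 1 e) := f.map_restrict _ _

theorem edgeTarget_map (f : (blowup p).Auto) (e : (blowup p).Cube 1) :
    edgeTarget (f.map 1 e) = autoRegion f (edgeTarget e) := by
  rw [← edgeSource_rev, ← edgeSource_rev, ← map_rev, edgeSource_map]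

/-- An automorphism that preserves oriented labels is the identity.  Whether a region and its image
lie on the same side of `P_i` does not change along edges, and they do so at the ends of an edge
labelled `P_i`. -/
theorem WhiteheadPartition.IsCompatibleCollection.eq_id_of_edgeLabel
    (hp : IsCompatibleCollection p) (f : (blowup p).Auto)
    (hf : ∀ e, edgeLabel (f.map 1 e) = edgeLabel e) : f = CubeComplex.Auto.id _ := by
  have hR : ∀ R, autoRegion f R = R := by
    intro R
    refine Region.ext fun i => ?_
    obtain ⟨e₀, he₀⟩ := hp.exists_edgeLabel (p := p) (Sum.inr i, false)
    have aux : ∀ (e : (blowup p).Cube 1) b, edgeLabel e = (Sum.inr i, b) →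
        (autoRegion f (edgeSource e)).1 i = (edgeSource e).1 i := by
      intro e b he
      have h1 := isBlowupEdge_edge e
      have h2 := isBlowupEdge_edge (f.map 1 e)
      rw [hf, he] at h2
      rw [he] at h1
      rw [edgeSource_map] at h2
      exact h2.1.trans h1.1.symm
    refine hp.induction_toward (edgeSource e₀)
      (motive := fun R => (autoRegion f R).1 i = R.1 i) ?_ ?_ R
    · exact aux e₀ _ he₀
    · rintro R S j - hS ih
      obtain ⟨e, he1, he2, he3⟩ := exists_edge (isBlowupEdge_of_flip hS)
      subst he1
      by_cases hij : i = j
      · subst hij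
        exact aux e _ he3
      · have h2 := isBlowupEdge_edge (f.map 1 e)
        rw [hf, he3, edgeSource_map, edgeTarget_map, he2] at h2
        rw [← eq_of_flip h2.2 hij, ih, eq_of_flip hS hij]
  have hedge : ∀ e, f.map 1 e = e := fun e =>
    edge_ext (by rw [edgeSource_map, hR]) (hf e)
  refine CubeComplex.Auto.ext (funext fun n => Equiv.ext fun c => ?_)
  change f.map n c = c
  refine BlowupCube.ext_of_vert_false ?_ (funext fun i => ?_)
  · have h : (blowup p).vertexOf (f.map n c) (fun _ => false) =
        f.map 0 ((blowup p).vertexOf c fun _ => false) := (f.map_restrict _ _).symm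
    rw [vertexOf_eq, vertexOf_eq] at h
    have h' := congrArg vertexRegion h
    rw [vertexRegion_regionVertex] at h'
    exact h'.trans (hR _)
  · have h : (blowup p).edgeOf (f.map n c) i (fun _ => false) =
        f.map 1 ((blowup p).edgeOf c i fun _ => false) := (f.map_restrict _ _).symm
    rw [hedge] at h
    have h' := congrArg edgeLabel h
    rw [edgeLabel_edgeOf, edgeLabel_edgeOf] at h'
    simpa using h'

theorem WhiteheadPartition.IsCompatibleCollection.hyperplaneRigidity
    (hp : IsCompatibleCollection p) : (blowup p).HyperplaneRigidity := fun f hf =>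
  hp.eq_id_of_edgeLabel f fun e => (edgeLabel_eq_of_parallel (hf e)).symm

end Special

section Homology

open WhiteheadPartition

variable {V : Type u} {Γ : SimpleGraph V} {k : ℕ} {p : Fin k → WhiteheadPartition Γ}

/-! ### Intersection numbers -/

open Classical in
/-- Whether a region lies on the given side of a partition; zero for generators. -/
noncomputable def sideIndicator (R : Region p) : (V ⊕ Fin k) × Bool → ℤ
  | (Sum.inl _, _) => 0
  | (Sum.inr i, b) => if R.1 i = b then 1 else 0

/-- The net number of crossings, in the direction of the oriented label, of a path from `R` to `S`
along edges labelled by partitions. -/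
noncomputable def crossing (R S : Region p) (l : (V ⊕ Fin k) × Bool) : ℤ :=
  sideIndicator R l - sideIndicator S l

theorem sideIndicator_nonneg (R : Region p) (l : (V ⊕ Fin k) × Bool) : 0 ≤ sideIndicator R l := by
  obtain ⟨v | i, b⟩ := l
  · exact le_rfl
  · simp only [sideIndicator]; split_ifs <;> simp

theorem sideIndicator_le_one (R : Region p) (l : (V ⊕ Fin k) × Bool) : sideIndicator R l ≤ 1 := by
  obtain ⟨v | i, b⟩ := l
  · exact zero_le_one
  · simp only [sideIndicator]; split_ifs <;> simp

variable (p) in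
open Classical in
/-- The intersection number of the hyperplane with the given oriented label and a loop that consists
of an edge labelled `v` and a path along edges labelled by partitions. -/
noncomputable def loopNumber (v : V) : (V ⊕ Fin k) × Bool → ℤ
  | (Sum.inl w, b) => if w = v then (if b then -1 else 1) else 0
  | (Sum.inr i, b) =>
    (if (v, true) ∈ (p i).side b ∧ (v, false) ∈ (p i).side (!b) then 1 else 0) -
      (if (v, false) ∈ (p i).side b ∧ (v, true) ∈ (p i).side (!b) then 1 else 0)

open Classical in
/-- The signed intersection of an edge labelled `l'` with the hyperplane with oriented label `l`. -/
noncomputable def labelSign (l l' : (V ⊕ Fin k) × Bool) : ℤ :=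
  (if l = l' then 1 else 0) - (if l = (l'.1, !l'.2) then 1 else 0)

theorem WhiteheadPartition.IsCompatibleCollection.sign_eq (hp : IsCompatibleCollection p)
    (e e' : (blowup p).Cube 1) :
    (blowup p).sign e e' = labelSign (edgeLabel e) (edgeLabel e') := by
  classical
  unfold CubeComplex.sign labelSign
  rw [← edgeLabel_rev]
  exact congrArg₂ (fun s t : ℤ => s - t) (if_congr hp.parallel_iff rfl rfl)
    (if_congr hp.parallel_iff rfl rfl)

theorem boundary_single (e : (blowup p).Cube 1) :
    (blowup p).boundary (Finsupp.single e 1) =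
      Finsupp.single (regionVertex (edgeTarget e)) 1 -
        Finsupp.single (regionVertex (edgeSource e)) 1 := by
  simp [CubeComplex.boundary, source_eq, target_eq]

theorem dualCochain_single (e e' : (blowup p).Cube 1) :
    (blowup p).dualCochain e (Finsupp.single e' 1) = (blowup p).sign e e' := by
  simp [CubeComplex.dualCochain]

theorem labelSign_eq_crossing {R S : Region p} {i : Fin k} {b : Bool}
    (h : IsBlowupEdge p R S (Sum.inr i, b)) (l : (V ⊕ Fin k) × Bool) :
    labelSign l (Sum.inr i, b) = crossing R S l := by
  have h2 := h.1
  have h3 := eq_not_of_flip h.2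
  obtain ⟨v | j, c⟩ := l
  · simp [labelSign, crossing, sideIndicator]
  · by_cases hj : j = i
    · subst hj
      simp only [labelSign, crossing, sideIndicator, h3, h2]
      cases b <;> cases c <;> simp
    · simp [labelSign, crossing, sideIndicator, hj, eq_of_flip h.2 hj]

/-- Any two regions are joined by a chain of edges labelled by partitions, none of which leaves a
side that contains both regions. -/
theorem WhiteheadPartition.IsCompatibleCollection.exists_chain (hp : IsCompatibleCollection p)
    (R R' : Region p) : ∃ z : (blowup p).Cube 1 →₀ ℤ,
      (blowup p).boundary z =
        Finsupp.single (regionVertex R') 1 - Finsupp.single (regionVertex R) 1 ∧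
      (∀ e ∈ z.support, ∀ j, R.1 j = R'.1 j → (edgeSource e).1 j = R.1 j) ∧
      ∀ e, (blowup p).dualCochain e z = crossing R R' (edgeLabel e) := by
  classical
  refine hp.induction_toward R' (motive := fun R => ∃ z : (blowup p).Cube 1 →₀ ℤ,
    (blowup p).boundary z =
      Finsupp.single (regionVertex R') 1 - Finsupp.single (regionVertex R) 1 ∧
    (∀ e ∈ z.support, ∀ j, R.1 j = R'.1 j → (edgeSource e).1 j = R.1 j) ∧
    ∀ e, (blowup p).dualCochain e z = crossing R R' (edgeLabel e)) ?_ ?_ R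
  · refine ⟨0, by simp, by simp, fun e => ?_⟩
    obtain ⟨v | j, c⟩ := edgeLabel e <;> simp [crossing, sideIndicator]
  · rintro R S i hi hS ⟨z, hz1, hz2, hz3⟩
    obtain ⟨e, rfl, rfl, he3⟩ := exists_edge (isBlowupEdge_of_flip hS)
    refine ⟨Finsupp.single e 1 + z, ?_, fun e' he' j hj => ?_, fun e' => ?_⟩
    · rw [map_add, hz1, boundary_single]
      abel
    · have hji : j ≠ i := by
        rintro rfl
        exact hi hj
      rcases Finset.mem_union.1 (Finsupp.support_add he') with h | h
      · have := Finsupp.support_single_subset h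
        rw [Finset.mem_singleton.1 this]
      · rw [hz2 e' h j ((eq_of_flip hS hji).trans hj), eq_of_flip hS hji]
    · rw [map_add, hz3, dualCochain_single, hp.sign_eq, he3,
        labelSign_eq_crossing (isBlowupEdge_of_flip hS)]
      obtain ⟨v | j, c⟩ := edgeLabel e' <;> simp [crossing, sideIndicator]

/-- The path that closes up an edge labelled `v` undoes the switches of sides along the edge. -/
theorem crossing_eq_loopNumber {R S : Region p} {v : V} (h : IsBlowupEdge p R S (Sum.inl v, false))
    (i : Fin k) (b : Bool) : crossing S R (Sum.inr i, b) = loopNumber p v (Sum.inr i, b) := by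
  classical
  have h2 := h.2 i
  change _ ↔ _ ∧ (v, true) ∉ _ at h2
  have e1 := mem_side_not (p := p i) (b := R.1 i) (x := (v, true))
  have e2 := mem_side_not (p := p i) (b := R.1 i) (x := (v, false))
  have hb : b = R.1 i ∨ b = !R.1 i := by cases b <;> cases R.1 i <;> simp
  rcases h.1 i with h3 | h3
  · have l1 : (v, false) ∉ (p i).link := notMem_link h3
    have l2 : (v, true) ∉ (p i).link := l1
    by_cases h4 : (v, true) ∈ (p i).side (R.1 i)
    · have hS : S.1 i = R.1 i := by
        by_contra hne
        exact (h2.1 hne).2 h4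
      simp only [h3, h4, not_true_eq_false, false_and, iff_false] at e1 e2
      rcases hb with rfl | rfl <;>
        simp [crossing, sideIndicator, loopNumber, hS, h3, h4, e1, e2]
    · have hS : S.1 i = !R.1 i := Bool.eq_not.2 (h2.2 ⟨h3, h4⟩)
      simp only [h3, h4, l2, not_true_eq_false, not_false_eq_true, false_and, true_and,
        iff_false, iff_true] at e1 e2
      rcases hb with rfl | rfl <;>
        simp [crossing, sideIndicator, loopNumber, hS, h3, h4, e1, e2]
  · have n1 : ∀ c, (v, false) ∉ (p i).side c := fun c h' => notMem_link h' h3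
    have n2 : ∀ c, (v, true) ∉ (p i).side c := fun c h' => notMem_link h' h3
    have hS : S.1 i = R.1 i := by
      by_contra hne
      exact n1 _ (h2.1 hne).1
    simp [crossing, sideIndicator, loopNumber, hS, n1, n2]

theorem labelSign_add_crossing {R S : Region p} {v : V}
    (h : IsBlowupEdge p R S (Sum.inl v, false)) (l : (V ⊕ Fin k) × Bool) :
    labelSign l (Sum.inl v, false) + crossing S R l = loopNumber p v l := by
  obtain ⟨w | i, b⟩ := l
  · by_cases hw : w = v
    · subst hw
      cases b <;> simp [labelSign, crossing, sideIndicator, loopNumber]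
    · simp [labelSign, crossing, sideIndicator, loopNumber, hw]
  · rw [← crossing_eq_loopNumber h]
    simp [labelSign]

/-- Through every region with `v ∈ I(R)` there is a loop that consists of an edge labelled `v` and a
path along edges labelled by partitions.  It stays in all sides that contain both `v` and `v⁻¹`. -/
theorem WhiteheadPartition.IsCompatibleCollection.exists_loop (hp : IsCompatibleCollection p)
    {R : Region p} {v : V} (hR : (v, false) ∈ regionLits p R) :
    ∃ z : (blowup p).Cube 1 →₀ ℤ, z ∈ LinearMap.ker (blowup p).boundary ∧
      (∀ e ∈ z.support, ∀ i, (∀ b, (v, false) ∈ (p i).side b → (v, true) ∈ (p i).side b) →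
        (edgeSource e).1 i = R.1 i) ∧
      ∀ e, (blowup p).dualCochain e z = loopNumber p v (edgeLabel e) := by
  classical
  obtain ⟨S, hS⟩ := exists_generator_edge hR
  obtain ⟨e, rfl, rfl, he3⟩ := exists_edge hS
  obtain ⟨z, hz1, hz2, hz3⟩ := hp.exists_chain (edgeTarget e) (edgeSource e)
  refine ⟨Finsupp.single e 1 + z, ?_, fun e' he' i hi => ?_, fun e' => ?_⟩
  · rw [LinearMap.mem_ker, map_add, hz1, boundary_single]
    abel
  · rcases Finset.mem_union.1 (Finsupp.support_add he') with h | h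
    · have := Finsupp.support_single_subset h
      rw [Finset.mem_singleton.1 this]
    · have h1 : (edgeTarget e).1 i = (edgeSource e).1 i := by
        by_contra hne
        obtain ⟨h2, h3⟩ := (hS.2 i).1 hne
        exact h3 (hi _ h2)
      rw [hz2 e' h i h1, h1]
  · rw [map_add, hz3, dualCochain_single, hp.sign_eq, he3, labelSign_add_crossing hS]

theorem CubeComplex.intersection_mk (X : CubeComplex.{u}) (e : X.Cube 1) {z : X.Cube 1 →₀ ℤ}
    (hz : z ∈ LinearMap.ker X.boundary) :
    X.intersection e (Submodule.Quotient.mk ⟨z, hz⟩) = X.dualCochain e z := rfl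

theorem WhiteheadPartition.IsCompatibleCollection.exists_class (hp : IsCompatibleCollection p)
    (v : V) : ∃ α : (blowup p).H1, ∀ e,
      (blowup p).intersection e α = loopNumber p v (edgeLabel e) := by
  obtain ⟨R, hR⟩ := hp.exists_regionLits (v, false)
  obtain ⟨z, hz, -, h⟩ := hp.exists_loop hR
  exact ⟨Submodule.Quotient.mk ⟨z, hz⟩, fun e => (CubeComplex.intersection_mk _ e hz).trans (h e)⟩

theorem loopNumber_self (v : V) (b : Bool) : loopNumber p v (Sum.inl v, b) ≠ 0 := by
  cases b <;> simp [loopNumber]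

theorem loopNumber_of_ne {v w : V} (h : w ≠ v) (b : Bool) :
    loopNumber p v (Sum.inl w, b) = 0 := by
  simp [loopNumber, h]

/-- A generator off the link of `P_i` has vanishing intersection number with `P_i` if and only if
it is not a single. -/
theorem loopNumber_inr_eq_zero {v : V} {i : Fin k} {b : Bool} :
    loopNumber p v (Sum.inr i, b) = 0 ↔
      ∀ a c, (v, a) ∈ (p i).side c → litInv (v, a) ∈ (p i).side c := by
  classical
  have e1 := mem_side_not (p := p i) (b := b) (x := (v, true))
  have e2 := mem_side_not (p := p i) (b := b) (x := (v, false))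
  have l1 : (v, true) ∈ (p i).link ↔ (v, false) ∈ (p i).link := Iff.rfl
  have d1 : (v, false) ∈ (p i).side b → (v, false) ∉ (p i).link := notMem_link
  have d2 : (v, true) ∈ (p i).side b → (v, true) ∉ (p i).link := notMem_link
  have key : (∀ a c, (v, a) ∈ (p i).side c → litInv (v, a) ∈ (p i).side c) ↔
      ((v, false) ∈ (p i).side b ↔ (v, true) ∈ (p i).side b) := by
    constructor
    · intro h
      exact ⟨h false b, h true b⟩
    · intro h a c
      by_cases hc : c = b
      · subst hc
        cases a
        · exact h.1
        · exact h.2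
      · rw [Bool.eq_not.2 hc]
        cases a
        · change _ → (v, true) ∈ _
          rw [e1, e2]; tauto
        · change _ → (v, false) ∈ _
          rw [e1, e2]; tauto
  rw [key]
  simp only [loopNumber, e1, e2]
  by_cases h1 : (v, false) ∈ (p i).side b <;> by_cases h2 : (v, true) ∈ (p i).side b <;>
    simp_all

theorem loopNumber_base (i : Fin k) (b : Bool) :
    loopNumber p (p i).base.1 (Sum.inr i, b) ≠ 0 := by
  intro h
  have h1 := loopNumber_inr_eq_zero.1 h _ _ ((p i).sideBase_mem b)
  exact (p i |>.isPair_side b).inv_notMem h1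

theorem loopNumber_of_mem_link {v : V} {i : Fin k} (h : (v, false) ∈ (p i).link) (b : Bool) :
    loopNumber p v (Sum.inr i, b) = 0 :=
  loopNumber_inr_eq_zero.2 fun a _ h' => absurd (show (v, a) ∈ (p i).link from h) (notMem_link h')

/-- For two crossing hyperplanes, the loop of a generator label, or of the base of a partition,
meets one of them exactly once and the other one not at all. -/
theorem WhiteheadPartition.IsCompatibleCollection.crossingCondition
    (hp : IsCompatibleCollection p) : (blowup p).CrossingCondition := by
  rintro K L hne (rfl | h)
  · exact absurd rfl hne
  have hc := labelCommute_of_cross h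
  have key : ∃ v, ∀ a b, loopNumber p v (hyperplaneLabel K, a) ≠
      loopNumber p v (hyperplaneLabel L, b) := by
    revert hc
    generalize hyperplaneLabel K = l
    generalize hyperplaneLabel L = l'
    intro hc
    cases l with
    | inl v =>
      refine ⟨v, fun a b => ?_⟩
      have h0 : loopNumber p v (l', b) = 0 := by
        cases l' with
        | inl w =>
          refine loopNumber_of_ne ?_ b
          rintro rfl
          exact labelCommute_irrefl p _ hc
        | inr i => exact loopNumber_of_mem_link hc b
      rw [h0]
      exact loopNumber_self v a
    | inr i =>
      cases l' with
      | inl w =>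
        refine ⟨w, fun a b => ?_⟩
        rw [loopNumber_of_mem_link hc a]
        exact (loopNumber_self w b).symm
      | inr j =>
        refine ⟨(p i).base.1, fun a b => ?_⟩
        rw [loopNumber_of_mem_link (i := j)
          (SimpleGraph.Adj.symm (commute_iff.1 (labelCommute_inr.1 hc))) b]
        exact loopNumber_base i a
  obtain ⟨v, hv⟩ := key
  obtain ⟨α, hα⟩ := hp.exists_class v
  refine ⟨α, ?_⟩
  rintro e₁ e₂ rfl rfl
  rw [hα, hα]
  exact hv (edgeLabel e₁).2 (edgeLabel e₂).2

end Homology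

section Components

open WhiteheadPartition

variable {V : Type u} {Γ : SimpleGraph V} {k : ℕ} {p : Fin k → WhiteheadPartition Γ}

/-! ### Complements of hyperplanes -/

/-- The component of a region in the complement of a set of hyperplanes. -/
def regionComponent (𝓗 : Set (blowup p).Hyperplane) (R : Region p) : (blowup p).Component 𝓗 :=
  (blowup p).component 𝓗 (regionVertex R)

theorem exists_regionComponent {𝓗 : Set (blowup p).Hyperplane} (C : (blowup p).Component 𝓗) :
    ∃ R, regionComponent 𝓗 R = C := by
  obtain ⟨x, rfl⟩ := Quot.exists_rep C
  refine ⟨vertexRegion x, ?_⟩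
  unfold regionComponent
  rw [regionVertex_vertexRegion]
  rfl

theorem component_eq_regionComponent (𝓗 : Set (blowup p).Hyperplane) (x : (blowup p).Cube 0) :
    (blowup p).component 𝓗 x = regionComponent 𝓗 (vertexRegion x) := by
  unfold regionComponent
  rw [regionVertex_vertexRegion]

theorem regionComponent_eq_of_edge {𝓗 : Set (blowup p).Hyperplane} {R S : Region p}
    {l : (V ⊕ Fin k) × Bool} (h : IsBlowupEdge p R S l)
    (hl : ∀ K ∈ 𝓗, hyperplaneLabel K ≠ l.1) : regionComponent 𝓗 R = regionComponent 𝓗 S := by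
  obtain ⟨e, rfl, rfl, rfl⟩ := exists_edge h
  refine Quot.sound ⟨e, fun he => hl _ he rfl, source_eq e, target_eq e⟩

/-- Regions on the same sides of the partitions that label hyperplanes of `𝓗` lie in one component
of the complement of `𝓗`. -/
theorem WhiteheadPartition.IsCompatibleCollection.regionComponent_eq
    (hp : IsCompatibleCollection p) {𝓗 : Set (blowup p).Hyperplane} {R R' : Region p}
    (h : ∀ i, (∃ K ∈ 𝓗, hyperplaneLabel K = Sum.inr i) → R.1 i = R'.1 i) :
    regionComponent 𝓗 R = regionComponent 𝓗 R' := by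
  revert h
  refine hp.induction_toward R' (motive := fun R =>
    (∀ i, (∃ K ∈ 𝓗, hyperplaneLabel K = Sum.inr i) → R.1 i = R'.1 i) →
    regionComponent 𝓗 R = regionComponent 𝓗 R') (fun _ => rfl) ?_ R
  intro R S i hi hS ih h
  have hi' : ∀ K ∈ 𝓗, hyperplaneLabel K ≠ Sum.inr i := fun K hK hl => hi (h i ⟨K, hK, hl⟩)
  refine (regionComponent_eq_of_edge (isBlowupEdge_of_flip hS) hi').trans (ih fun j hj => ?_)
  have hji : j ≠ i := by
    rintro rfl
    exact hi (h j hj)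
  rw [eq_of_flip hS hji, h j hj]

/-- An edge labelled by the literal `x` joins two components, or lies in one. -/
theorem WhiteheadPartition.IsCompatibleCollection.exists_joined (hp : IsCompatibleCollection p)
    (x : V × Bool) : ∃ R S : Region p, x ∈ regionLits p R ∧ litInv x ∈ regionLits p S ∧
      ∀ 𝓗 : Set (blowup p).Hyperplane, (∀ K ∈ 𝓗, hyperplaneLabel K ≠ Sum.inl x.1) →
        regionComponent 𝓗 R = regionComponent 𝓗 S := by
  obtain ⟨R, hR⟩ := hp.exists_regionLits x
  obtain ⟨S, hS⟩ := exists_generator_edge (v := x.1) (b := x.2) hR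
  exact ⟨R, S, hR, hS.reverse.1, fun 𝓗 h => regionComponent_eq_of_edge hS h⟩

theorem not_separates {𝓗 : Set (blowup p).Hyperplane}
    (h : ∀ R R', regionComponent 𝓗 R = regionComponent 𝓗 R') : ¬ (blowup p).Separates 𝓗 := by
  rintro ⟨C, D, hne⟩
  obtain ⟨R, rfl⟩ := exists_regionComponent C
  obtain ⟨S, rfl⟩ := exists_regionComponent D
  exact hne (h R S)

theorem containedIn_of_generator {𝓗 : Set (blowup p).Hyperplane} {L : (blowup p).Hyperplane}
    {w : V} (hL : hyperplaneLabel L = Sum.inl w) {C : (blowup p).Component 𝓗}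
    (h1 : ∀ K ∈ 𝓗, hyperplaneLabel K ≠ Sum.inl w)
    (h2 : ∀ K ∈ 𝓗, ¬ LabelCommute p (Sum.inl w) (hyperplaneLabel K))
    (h3 : ∀ b R, (w, b) ∈ regionLits p R → regionComponent 𝓗 R = C) :
    (blowup p).ContainedIn L C := by
  refine ⟨fun K hK hM => ?_, fun e he => ?_⟩
  · rcases hM with rfl | hM
    · exact h1 _ hK hL
    · exact h2 K hK (hL ▸ labelCommute_of_cross hM)
  · have hl : (edgeLabel e).1 = Sum.inl w := by rw [← hL, ← he, hyperplaneLabel_dual]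
    have he : IsBlowupEdge p (edgeSource e) (edgeTarget e) (Sum.inl w, (edgeLabel e).2) := by
      rw [← hl]; exact isBlowupEdge_edge e
    rw [source_eq, target_eq]
    exact ⟨h3 _ _ he.1, h3 _ _ he.reverse.1⟩

/-! ### Pairs of hyperplanes that separate -/

/-- A generator `w` whose hyperplane satisfies the condition on pairs of hyperplanes for the
component `C`. -/
def IsWitness (𝓗 : Set (blowup p).Hyperplane) (C : (blowup p).Component 𝓗) (w : V) : Prop :=
  (∀ K ∈ 𝓗, hyperplaneLabel K ≠ Sum.inl w ∧ ¬ LabelCommute p (Sum.inl w) (hyperplaneLabel K)) ∧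
  (∀ b R, (w, b) ∈ regionLits p R → regionComponent 𝓗 R = C) ∧
  ∀ L, hyperplaneLabel L = Sum.inl w → ∀ R R', regionComponent 𝓗 R = C →
    regionComponent 𝓗 R' = C → regionComponent (insert L 𝓗) R = regionComponent (insert L 𝓗) R'

theorem WhiteheadPartition.IsCompatibleCollection.exists_of_isWitness
    (hp : IsCompatibleCollection p) {𝓗 : Set (blowup p).Hyperplane} {C : (blowup p).Component 𝓗}
    {w : V} (h : IsWitness 𝓗 C w) : ∃ L : (blowup p).Hyperplane,
      (blowup p).ContainedIn L C ∧ ¬ (blowup p).Separates {L} ∧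
        (blowup p).NonSeparatingIn L C := by
  obtain ⟨L, hL⟩ := hp.exists_hyperplaneLabel (Sum.inl w)
  refine ⟨L, containedIn_of_generator hL (fun K hK => (h.1 K hK).1) (fun K hK => (h.1 K hK).2)
    h.2.1, not_separates fun R R' => hp.regionComponent_eq ?_, fun x y hx hy => ?_⟩
  · rintro i ⟨K, rfl, hK⟩
    rw [hL] at hK
    cases hK
  · rw [component_eq_regionComponent] at hx hy ⊢
    rw [component_eq_regionComponent]
    exact h.2.2 L hL _ _ hx hy

theorem exists_ne_sideBase (q : WhiteheadPartition Γ) (b : Bool) :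
    ∃ w ∈ q.side b, w.1 ≠ q.base.1 := by
  obtain ⟨w, hw, hne⟩ := (q.isPair_side b).nontrivial.exists_ne (q.sideBase b)
  refine ⟨w, hw, fun h => ?_⟩
  have h2 : w = litInv (q.sideBase b) := by
    refine Prod.ext h ?_
    have : w.2 ≠ (q.sideBase b).2 := fun h' => hne (Prod.ext h h')
    exact Bool.eq_not.2 this
  exact (q.isPair_side b).inv_notMem (h2 ▸ hw)

/-- A generator and a partition: if their hyperplanes separate, then the generator is the only
single of the partition, and any other generator on a side of the partition is a witness. -/
theorem WhiteheadPartition.IsCompatibleCollection.exists_isWitness_inl_inr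
    (hp : IsCompatibleCollection p) {𝓗 : Set (blowup p).Hyperplane} {v : V} {i : Fin k}
    (h𝓗 : ∀ K, K ∈ 𝓗 ↔ hyperplaneLabel K = Sum.inl v ∨ hyperplaneLabel K = Sum.inr i)
    (hsep : (blowup p).Separates 𝓗) (C : (blowup p).Component 𝓗) : ∃ w, IsWitness 𝓗 C w := by
  have agree : ∀ R R' : Region p, R.1 i = R'.1 i → regionComponent 𝓗 R = regionComponent 𝓗 R' := by
    refine fun R R' h => hp.regionComponent_eq ?_
    rintro j ⟨K, hK, hl⟩
    rcases (h𝓗 K).1 hK with h' | h' <;> rw [hl] at h' <;> cases h'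
    exact h
  have bridge : ∀ R R' : Region p, R.1 i ≠ R'.1 i → regionComponent 𝓗 R ≠ regionComponent 𝓗 R' := by
    intro R R' hne h
    refine not_separates (𝓗 := 𝓗) ?_ hsep
    have key : ∀ S, regionComponent 𝓗 S = regionComponent 𝓗 R := by
      intro S
      by_cases hS : S.1 i = R.1 i
      · exact agree _ _ hS
      · rw [h]
        refine agree _ _ ?_
        revert hS hne
        cases S.1 i <;> cases R.1 i <;> cases R'.1 i <;> simp
    exact fun S S' => (key S).trans (key S').symm
  have single : ∀ x : V × Bool, ∀ b, x ∈ (p i).side b → litInv x ∈ (p i).side (!b) → x.1 = v := by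
    intro x b hx hx'
    by_contra hne
    obtain ⟨R, S, hR, hS, hRS⟩ := hp.exists_joined x
    refine bridge R S ?_ (hRS 𝓗 fun K hK => ?_)
    · rw [eq_of_mem_regionLits hR hx, eq_of_mem_regionLits hS hx']
      cases b <;> simp
    · rcases (h𝓗 K).1 hK with h' | h' <;> rw [h']
      · exact fun h => hne (Sum.inl_injective h).symm
      · simp
  have hbase : (p i).base.1 = v := by
    refine single ((p i).sideBase false) false ((p i).sideBase_mem _) ?_
    rw [litInv_sideBase]
    exact (p i).sideBase_mem _
  obtain ⟨R₀, rfl⟩ := exists_regionComponent C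
  obtain ⟨w, hw, hne⟩ := exists_ne_sideBase (p i) (R₀.1 i)
  have hw' : litInv w ∈ (p i).side (R₀.1 i) := by
    refine ((p i).mem_side_or _ (litInv_notMem_link hw)).resolve_right fun h => ?_
    exact hne ((single w _ hw h).trans hbase.symm)
  have both : ∀ c, (w.1, c) ∈ (p i).side (R₀.1 i) := by
    intro c
    by_cases hc : c = w.2
    · rw [hc]; exact hw
    · rw [Bool.eq_not.2 hc]; exact hw'
  refine ⟨w.1, fun K hK => ?_, fun b R hR => agree _ _ (eq_of_mem_regionLits hR (both b)), ?_⟩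
  · rcases (h𝓗 K).1 hK with h' | h' <;> rw [h']
    · refine ⟨fun h => hne ((Sum.inl_injective h).symm.trans hbase.symm), fun h => ?_⟩
      rw [← hbase] at h
      exact (p i).isPair_side _ |>.not_adj w hw (SimpleGraph.Adj.symm h)
    · exact ⟨by simp, notMem_link (x := w) hw⟩
  · intro L hL R R' hR hR'
    have h1 : ∀ R, regionComponent 𝓗 R = regionComponent 𝓗 R₀ → R.1 i = R₀.1 i := by
      intro R hR
      by_contra hne
      exact bridge _ _ hne hR
    refine hp.regionComponent_eq ?_
    rintro j ⟨K, hK | hK, hl⟩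
    · rw [hK, hL] at hl
      cases hl
    · rcases (h𝓗 K).1 hK with h' | h' <;> rw [hl] at h' <;> cases h'
      rw [h1 R hR, h1 R' hR']

/-- Two partitions: if their hyperplanes separate, then there are a side of each that are disjoint;
the regions off both of these sides form one component of the complement, and the regions on one of
them form the other. -/
theorem WhiteheadPartition.IsCompatibleCollection.exists_isWitness_inr_inr
    (hp : IsCompatibleCollection p) {𝓗 : Set (blowup p).Hyperplane} {i j : Fin k} {a b : Bool}
    (hd : (p i).Disj a (p j) b)
    (h𝓗 : ∀ K, K ∈ 𝓗 ↔ hyperplaneLabel K = Sum.inr i ∨ hyperplaneLabel K = Sum.inr j)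
    (hsep : (blowup p).Separates 𝓗) (C : (blowup p).Component 𝓗) : ∃ w, IsWitness 𝓗 C w := by
  have agree' : ∀ {L : (blowup p).Hyperplane} {w : V}, hyperplaneLabel L = Sum.inl w →
      ∀ R R' : Region p, R.1 i = R'.1 i → R.1 j = R'.1 j →
        regionComponent (insert L 𝓗) R = regionComponent (insert L 𝓗) R' := by
    refine fun hL R R' h h' => hp.regionComponent_eq ?_
    rintro l ⟨K, hK | hK, hl⟩
    · rw [hK, hL] at hl
      cases hl
    · rcases (h𝓗 K).1 hK with h' | h' <;> rw [hl] at h' <;> cases h' <;> assumption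
  have agree : ∀ R R' : Region p, R.1 i = R'.1 i → R.1 j = R'.1 j →
      regionComponent 𝓗 R = regionComponent 𝓗 R' := by
    refine fun R R' h h' => hp.regionComponent_eq ?_
    rintro l ⟨K, hK, hl⟩
    rcases (h𝓗 K).1 hK with h' | h' <;> rw [hl] at h' <;> cases h' <;> assumption
  have hgen : ∀ K ∈ 𝓗, ∀ w : V, hyperplaneLabel K ≠ Sum.inl w := by
    intro K hK w h
    rcases (h𝓗 K).1 hK with h' | h' <;> rw [h'] at h <;> cases h
  have joined : ∀ x : V × Bool, ∃ R S : Region p, x ∈ regionLits p R ∧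
      litInv x ∈ regionLits p S ∧ regionComponent 𝓗 R = regionComponent 𝓗 S := by
    intro x
    obtain ⟨R, S, hR, hS, h⟩ := hp.exists_joined x
    exact ⟨R, S, hR, hS, h 𝓗 fun K hK => hgen K hK _⟩
  have sideJ : ∀ R : Region p, R.1 i = a → R.1 j = !b := by
    intro R hR
    rw [Bool.eq_not]
    intro h
    exact R.not_disj i j (by rw [hR, h]; exact hd)
  have sideI : ∀ R : Region p, R.1 j = b → R.1 i = !a := by
    intro R hR
    rw [Bool.eq_not]
    intro h
    exact R.not_disj i j (by rw [hR, h]; exact hd)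
  have hxj : (p i).sideBase (!a) ∉ (p j).link := sideBase_notMem_link hd.1 _
  have hyi : (p j).sideBase (!b) ∉ (p i).link := sideBase_notMem_link hd.symm.1 _
  -- If the middle part is joined to one of the outer parts, then there is only one component, as
  -- the bases join each outer part to another part.
  have merge₁ : ∀ R S : Region p, R.1 i = a → S.1 i = !a → S.1 j = !b →
      regionComponent 𝓗 R ≠ regionComponent 𝓗 S := by
    intro R S hR hSi hSj h
    refine not_separates (𝓗 := 𝓗) ?_ hsep
    have k1 : ∀ T : Region p, T.1 j = !b → regionComponent 𝓗 T = regionComponent 𝓗 S := by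
      intro T hT
      by_cases hTi : T.1 i = a
      · rw [← h]
        exact agree _ _ (hTi.trans hR.symm) (hT.trans (sideJ R hR).symm)
      · exact agree _ _ ((Bool.eq_not.2 hTi).trans hSi.symm) (hT.trans hSj.symm)
    have k2 : ∀ T : Region p, T.1 j = b → regionComponent 𝓗 T = regionComponent 𝓗 S := by
      intro T hT
      obtain ⟨T', T'', h1, h2, h3⟩ := joined ((p j).sideBase b)
      rw [litInv_sideBase] at h2
      have h1' := eq_of_mem_regionLits h1 ((p j).sideBase_mem _)
      rw [← k1 T'' (eq_of_mem_regionLits h2 ((p j).sideBase_mem _)), ← h3]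
      exact agree _ _ ((sideI T hT).trans (sideI T' h1').symm) (hT.trans h1'.symm)
    have k3 : ∀ T, regionComponent 𝓗 T = regionComponent 𝓗 S := fun T => by
      by_cases hT : T.1 j = b
      · exact k2 T hT
      · exact k1 T (Bool.eq_not.2 hT)
    exact fun T T' => (k3 T).trans (k3 T').symm
  have merge₃ : ∀ R S : Region p, R.1 j = b → S.1 i = !a → S.1 j = !b →
      regionComponent 𝓗 R ≠ regionComponent 𝓗 S := by
    intro R S hR hSi hSj h
    refine not_separates (𝓗 := 𝓗) ?_ hsep
    have k1 : ∀ T : Region p, T.1 i = !a → regionComponent 𝓗 T = regionComponent 𝓗 S := by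
      intro T hT
      by_cases hTj : T.1 j = b
      · rw [← h]
        exact agree _ _ (hT.trans (sideI R hR).symm) (hTj.trans hR.symm)
      · exact agree _ _ (hT.trans hSi.symm) ((Bool.eq_not.2 hTj).trans hSj.symm)
    have k2 : ∀ T : Region p, T.1 i = a → regionComponent 𝓗 T = regionComponent 𝓗 S := by
      intro T hT
      obtain ⟨T', T'', h1, h2, h3⟩ := joined ((p i).sideBase a)
      rw [litInv_sideBase] at h2
      have h1' := eq_of_mem_regionLits h1 ((p i).sideBase_mem _)
      rw [← k1 T'' (eq_of_mem_regionLits h2 ((p i).sideBase_mem _)), ← h3]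
      exact agree _ _ (hT.trans h1'.symm) ((sideJ T hT).trans (sideJ T' h1').symm)
    have k3 : ∀ T, regionComponent 𝓗 T = regionComponent 𝓗 S := fun T => by
      by_cases hT : T.1 i = a
      · exact k2 T hT
      · exact k1 T (Bool.eq_not.2 hT)
    exact fun T T' => (k3 T).trans (k3 T').symm
  have lit₁ : ∀ z : V × Bool, z ∈ (p i).side a → litInv z ∈ (p i).side (!a) →
      litInv z ∉ (p j).side (!b) := by
    intro z h1 h2 h3
    obtain ⟨R, S, hR, hS, h⟩ := joined z
    exact merge₁ R S (eq_of_mem_regionLits hR h1) (eq_of_mem_regionLits hS h2)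
      (eq_of_mem_regionLits hS h3) h
  have lit₃ : ∀ z : V × Bool, z ∈ (p j).side b → litInv z ∈ (p i).side (!a) →
      litInv z ∉ (p j).side (!b) := by
    intro z h1 h2 h3
    obtain ⟨R, S, hR, hS, h⟩ := joined z
    exact merge₃ R S (eq_of_mem_regionLits hR h1) (eq_of_mem_regionLits hS h2)
      (eq_of_mem_regionLits hS h3) h
  have hxJ : (p i).sideBase (!a) ∈ (p j).side b := by
    refine ((p j).mem_side_or b hxj).resolve_right ?_
    rw [← litInv_sideBase]
    refine lit₁ _ ((p i).sideBase_mem a) ?_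
    rw [litInv_sideBase]
    exact (p i).sideBase_mem _
  have hyI : (p j).sideBase (!b) ∈ (p i).side a := by
    refine ((p i).mem_side_or a hyi).resolve_right fun h => ?_
    rw [← litInv_sideBase] at h
    refine lit₃ _ ((p j).sideBase_mem b) h ?_
    rw [litInv_sideBase]
    exact (p j).sideBase_mem _
  have lits : ∀ (w : V × Bool) (i : Fin k) (a : Bool), w ∈ (p i).side a →
      litInv w ∈ (p i).side a → ∀ c, (w.1, c) ∈ (p i).side a := by
    intro w i a h h' c
    by_cases hc : c = w.2
    · rw [hc]; exact h
    · rw [Bool.eq_not.2 hc]; exact h'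
  have avoid : ∀ w : V, (w, false) ∉ (p i).link → (w, false) ∉ (p j).link → ∀ K ∈ 𝓗,
      hyperplaneLabel K ≠ Sum.inl w ∧ ¬ LabelCommute p (Sum.inl w) (hyperplaneLabel K) := by
    intro w h1 h2 K hK
    refine ⟨hgen K hK w, ?_⟩
    rcases (h𝓗 K).1 hK with h' | h' <;> rw [h']
    · exact h1
    · exact h2
  obtain ⟨R₀, rfl⟩ := exists_regionComponent C
  -- In the middle part, no literal off both partitions is a single, as it would join two parts.
  by_cases hmid : R₀.1 i = !a ∧ R₀.1 j = !b
  · obtain ⟨hi, hj⟩ := hmid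
    have hne : ((p i).side (!a) ∩ (p j).side (!b)).Nonempty := by
      rcases R₀.2 i j with h | h
      · exact absurd h hd.1
      · rwa [hi, hj] at h
    obtain ⟨w, hwi, hwj⟩ := hne
    have hwi' : litInv w ∈ (p i).side (!a) := by
      refine ((p i).mem_side_or a (litInv_notMem_link hwi)).resolve_left fun h => ?_
      exact lit₁ _ h (by rwa [litInv_litInv]) (by rwa [litInv_litInv])
    have hwj' : litInv w ∈ (p j).side (!b) := by
      refine ((p j).mem_side_or b (litInv_notMem_link hwj)).resolve_left fun h => ?_
      exact lit₃ _ h (by rwa [litInv_litInv]) (by rwa [litInv_litInv])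
    refine ⟨w.1, avoid _ (notMem_link (x := w) hwi) (notMem_link (x := w) hwj),
      fun c R hR => ?_, ?_⟩
    · refine agree _ _ ?_ ?_
      · rw [eq_of_mem_regionLits hR (lits w i _ hwi hwi' c), hi]
      · rw [eq_of_mem_regionLits hR (lits w j _ hwj hwj' c), hj]
    · intro L hL R R' hR hR'
      have k1 : ∀ R, regionComponent 𝓗 R = regionComponent 𝓗 R₀ → R.1 i = !a ∧ R.1 j = !b := by
        intro R hR
        rw [Bool.eq_not, Bool.eq_not]
        exact ⟨fun h => merge₁ R R₀ h hi hj hR, fun h => merge₃ R R₀ h hi hj hR⟩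
      exact agree' hL _ _ ((k1 R hR).1.trans (k1 R' hR').1.symm)
        ((k1 R hR).2.trans (k1 R' hR').2.symm)
  · have outer : ∀ R : Region p, ¬ (R.1 i = !a ∧ R.1 j = !b) ↔ R.1 i = a ∨ R.1 j = b := by
      intro R
      cases R.1 i <;> cases R.1 j <;> cases a <;> cases b <;> simp
    -- a generator that joins the two outer parts keeps them joined in the complement of `L`
    have connect : ∀ (L : (blowup p).Hyperplane) (w : V), hyperplaneLabel L = Sum.inl w →
        ∀ z : V × Bool, z.1 ≠ w → z ∈ (p i).side a → litInv z ∈ (p j).side b →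
        ∀ R R' : Region p, (R.1 i = a ∨ R.1 j = b) → (R'.1 i = a ∨ R'.1 j = b) →
        regionComponent (insert L 𝓗) R = regionComponent (insert L 𝓗) R' := by
      intro L w hL z hzw hz hz' R R' hR hR'
      obtain ⟨S, S', hS, hS', h⟩ := hp.exists_joined z
      have h0 := h (insert L 𝓗) (by
        rintro K (hK | hK)
        · rw [hK, hL]
          exact fun h => hzw (Sum.inl_injective h).symm
        · exact hgen K hK _)
      have hSi := eq_of_mem_regionLits hS hz
      have hSj := eq_of_mem_regionLits hS' hz'
      have k1 : ∀ R : Region p, (R.1 i = a ∨ R.1 j = b) →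
          regionComponent (insert L 𝓗) R = regionComponent (insert L 𝓗) S := by
        rintro R (hR | hR)
        · exact agree' hL _ _ (hR.trans hSi.symm) ((sideJ R hR).trans (sideJ S hSi).symm)
        · rw [h0]
          exact agree' hL _ _ ((sideI R hR).trans (sideI S' hSj).symm) (hR.trans hSj.symm)
      exact (k1 R hR).trans (k1 R' hR').symm
    have hx' : litInv ((p i).sideBase a) ∈ (p j).side b := by rwa [litInv_sideBase]
    have same : ∀ R R' : Region p, (R.1 i = a ∨ R.1 j = b) → (R'.1 i = a ∨ R'.1 j = b) →
        regionComponent 𝓗 R = regionComponent 𝓗 R' := by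
      obtain ⟨S, S', hS, hS', h⟩ := joined ((p i).sideBase a)
      have hSi := eq_of_mem_regionLits hS ((p i).sideBase_mem a)
      have hSj := eq_of_mem_regionLits hS' hx'
      have k1 : ∀ R : Region p, (R.1 i = a ∨ R.1 j = b) →
          regionComponent 𝓗 R = regionComponent 𝓗 S := by
        rintro R (hR | hR)
        · exact agree _ _ (hR.trans hSi.symm) ((sideJ R hR).trans (sideJ S hSi).symm)
        · rw [h]
          exact agree _ _ ((sideI R hR).trans (sideI S' hSj).symm) (hR.trans hSj.symm)
      exact fun R R' hR hR' => (k1 R hR).trans (k1 R' hR').symm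
    have hR₀ := (outer R₀).1 hmid
    have back : ∀ R, regionComponent 𝓗 R = regionComponent 𝓗 R₀ → R.1 i = a ∨ R.1 j = b := by
      intro R hR
      rw [← outer]
      rintro ⟨hi, hj⟩
      rcases hR₀ with h | h
      · exact merge₁ R₀ R h hi hj hR.symm
      · exact merge₃ R₀ R h hi hj hR.symm
    -- If a generator other than the base of `p i` joins the two outer parts, then the base is a
    -- witness.  Otherwise the two partitions have the same base, and any other generator on the side
    -- `a` of `p i` is a witness.
    by_cases hz : ∃ z : V × Bool, z.1 ≠ (p i).base.1 ∧ z ∈ (p i).side a ∧ litInv z ∈ (p j).side b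
    · obtain ⟨z, hzw, hz, hz'⟩ := hz
      refine ⟨(p i).base.1, avoid _ (fun h => Γ.irrefl h)
        (fun h => hd.1 (commute_iff.2 (SimpleGraph.Adj.symm h))), fun c R hR => ?_,
        fun L hL R R' hR hR' => connect L _ hL z hzw hz hz' R R' (back R hR) (back R' hR')⟩
      refine same _ _ ?_ hR₀
      by_cases hc : c = ((p i).sideBase a).2
      · rw [hc] at hR
        exact Or.inl (eq_of_mem_regionLits hR ((p i).sideBase_mem a))
      · rw [Bool.eq_not.2 hc] at hR
        exact Or.inr (eq_of_mem_regionLits (x := litInv ((p i).sideBase a)) hR hx')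
    · have hbase : (p j).base.1 = (p i).base.1 := by
        by_contra hne
        refine hz ⟨(p j).sideBase (!b), hne, hyI, ?_⟩
        rw [litInv_sideBase, Bool.not_not]
        exact (p j).sideBase_mem b
      obtain ⟨w, hw, hne⟩ := exists_ne_sideBase (p i) a
      have hwl : w ∉ (p j).link := by
        rw [mem_link, hbase]
        exact notMem_link hw
      have hw' : litInv w ∈ (p i).side a := by
        refine ((p i).mem_side_or a (litInv_notMem_link hw)).resolve_right fun h => ?_
        rcases (p j).mem_side_or b (x := litInv w) hwl with h' | h'
        · exact hz ⟨w, hne, hw, h'⟩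
        · exact lit₁ w hw h h'
      refine ⟨w.1, avoid _ (notMem_link (x := w) hw) hwl, fun c R hR => ?_,
        fun L hL R R' hR hR' => connect L _ hL ((p i).sideBase a) hne.symm ((p i).sideBase_mem a) hx'
          R R' (back R hR) (back R' hR')⟩
      exact same _ _ (Or.inl (eq_of_mem_regionLits hR (lits w i a hw hw' c))) hR₀

/-- The hyperplanes of two commuting partitions do not separate: the base of each partition labels
edges on both sides of the other one. -/
theorem WhiteheadPartition.IsCompatibleCollection.not_separates_of_commute
    (hp : IsCompatibleCollection p) {𝓗 : Set (blowup p).Hyperplane} {i j : Fin k}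
    (hc : (p i).Commute (p j))
    (h𝓗 : ∀ K, K ∈ 𝓗 ↔ hyperplaneLabel K = Sum.inr i ∨ hyperplaneLabel K = Sum.inr j) :
    ¬ (blowup p).Separates 𝓗 := by
  have agree : ∀ R R' : Region p, R.1 i = R'.1 i → R.1 j = R'.1 j →
      regionComponent 𝓗 R = regionComponent 𝓗 R' := by
    refine fun R R' h h' => hp.regionComponent_eq ?_
    rintro l ⟨K, hK, hl⟩
    rcases (h𝓗 K).1 hK with h' | h' <;> rw [hl] at h' <;> cases h' <;> assumption
  have hgen : ∀ K ∈ 𝓗, ∀ w : V, hyperplaneLabel K ≠ Sum.inl w := by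
    intro K hK w h
    rcases (h𝓗 K).1 hK with h' | h' <;> rw [h'] at h <;> cases h
  -- the base of `p i` joins its two sides without leaving the side `c` of `p j`
  have key : ∀ i j, (p i).Commute (p j) → ∀ c, ∃ R S : Region p, R.1 i = false ∧ S.1 i = true ∧
      R.1 j = c ∧ S.1 j = c ∧ regionComponent 𝓗 R = regionComponent 𝓗 S := by
    intro i j hc c
    have hl : (p i).sideBase false ∈ (p j).link := SimpleGraph.Adj.symm (commute_iff.1 hc)
    obtain ⟨R, hR, hRc⟩ := hp.exists_regionLits_of_link _ j hl c
    obtain ⟨S, hS⟩ := exists_generator_edge (v := (p i).base.1)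
      (b := ((p i).sideBase false).2) hR
    refine ⟨R, S, eq_of_mem_regionLits hR ((p i).sideBase_mem false), ?_, hRc, ?_,
      regionComponent_eq_of_edge hS fun K hK => hgen K hK _⟩
    · refine eq_of_mem_regionLits (x := litInv ((p i).sideBase false)) hS.reverse.1 ?_
      rw [litInv_sideBase]
      exact (p i).sideBase_mem true
    · by_contra hne
      rw [← hRc] at hne
      exact notMem_link ((hS.2 j).1 hne).1 hl
  refine not_separates ?_
  have k1 : ∀ R R' : Region p, R.1 j = R'.1 j →
      regionComponent 𝓗 R = regionComponent 𝓗 R' := by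
    intro R R' h
    obtain ⟨S, S', h1, h2, h3, h4, h5⟩ := key i j hc (R.1 j)
    have k : ∀ T : Region p, T.1 j = R.1 j → regionComponent 𝓗 T = regionComponent 𝓗 S := by
      intro T hT
      by_cases hTi : T.1 i = false
      · exact agree _ _ (hTi.trans h1.symm) (hT.trans h3.symm)
      · rw [h5]
        exact agree _ _ (by rw [h2]; simpa using hTi) (hT.trans h4.symm)
    exact (k R rfl).trans (k R' h.symm).symm
  obtain ⟨S, S', h1, h2, -, -, h5⟩ := key j i hc.symm false
  have k2 : ∀ T : Region p, regionComponent 𝓗 T = regionComponent 𝓗 S := by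
    intro T
    by_cases hT : T.1 j = false
    · exact k1 _ _ (hT.trans h1.symm)
    · rw [h5]
      exact k1 _ _ (by rw [h2]; simpa using hT)
  exact fun R R' => (k2 R).trans (k2 R').symm

theorem WhiteheadPartition.IsCompatibleCollection.separatingPairCondition
    (hp : IsCompatibleCollection p) : (blowup p).SeparatingPairCondition := by
  intro K₁ K₂ hM hsep C
  suffices h : ∃ w, IsWitness {K₁, K₂} C w from hp.exists_of_isWitness h.choose_spec
  have hne : hyperplaneLabel K₁ ≠ hyperplaneLabel K₂ :=
    fun h => hM (Or.inl (hp.hyperplaneLabel_injective h))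
  have h𝓗 : ∀ K, K ∈ ({K₁, K₂} : Set (blowup p).Hyperplane) ↔
      hyperplaneLabel K = hyperplaneLabel K₁ ∨ hyperplaneLabel K = hyperplaneLabel K₂ := fun K => by
    rw [hp.hyperplaneLabel_injective.eq_iff, hp.hyperplaneLabel_injective.eq_iff]
    rfl
  generalize ({K₁, K₂} : Set (blowup p).Hyperplane) = 𝓗 at *
  revert hne h𝓗
  generalize hyperplaneLabel K₁ = l₁
  generalize hyperplaneLabel K₂ = l₂
  intro hne h𝓗
  cases l₁ with
  | inl v =>
    cases l₂ with
    | inl w =>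
      refine absurd hsep (not_separates fun R R' => hp.regionComponent_eq ?_)
      rintro j ⟨K, hK, hl⟩
      rcases (h𝓗 K).1 hK with h' | h' <;> rw [hl] at h' <;> cases h'
    | inr i => exact hp.exists_isWitness_inl_inr h𝓗 hsep C
  | inr i =>
    cases l₂ with
    | inl v => exact hp.exists_isWitness_inl_inr (fun K => (h𝓗 K).trans or_comm) hsep C
    | inr j =>
      have hij : i ≠ j := fun h => hne (congrArg Sum.inr h)
      by_cases hc : (p i).Commute (p j)
      · exact absurd hsep (hp.not_separates_of_commute hc h𝓗)
      · obtain ⟨a, b, hd⟩ := hp.exists_disj hij hc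
        exact hp.exists_isWitness_inr_inr hd h𝓗 hsep C

end Components

section Criterion

open WhiteheadPartition

/-! ### Automorphisms and intersection numbers -/

namespace CubeComplex

variable {X : CubeComplex.{u}}

/-- The inverse of an automorphism. -/
def Auto.symm (f : X.Auto) : X.Auto where
  map n := (f.map n).symm
  map_restrict g c := by
    rw [Equiv.symm_apply_eq, f.map_restrict, Equiv.apply_symm_apply]

theorem Auto.parallel_map (f : X.Auto) {e e' : X.Cube 1} (h : X.Parallel e e') :
    X.Parallel (f.map 1 e) (f.map 1 e') := by
  induction h with
  | rel a b hab =>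
    obtain ⟨s, rfl, rfl⟩ := hab
    exact Relation.EqvGen.rel _ _
      ⟨f.map 2 s, (f.map_restrict _ _).symm, (f.map_restrict _ _).symm⟩
  | refl a => exact Relation.EqvGen.refl _
  | symm a b _ ih => exact Relation.EqvGen.symm _ _ ih
  | trans a b c _ _ ih ih' => exact Relation.EqvGen.trans _ _ _ ih ih'

theorem Auto.parallel_map_iff (f : X.Auto) {e e' : X.Cube 1} :
    X.Parallel (f.map 1 e) (f.map 1 e') ↔ X.Parallel e e' := by
  refine ⟨fun h => ?_, f.parallel_map⟩
  have := f.symm.parallel_map h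
  simpa [Auto.symm] using this

theorem Auto.dualCochain_chainMap (f : X.Auto) (e : X.Cube 1) (z : X.Cube 1 →₀ ℤ) :
    X.dualCochain (f.map 1 e) (f.chainMap z) = X.dualCochain e z := by
  have : X.dualCochain (f.map 1 e) ∘ₗ f.chainMap = X.dualCochain e := by
    refine Finsupp.lhom_ext fun e' a => ?_
    have hr : f.map 1 (X.rev e') = X.rev (f.map 1 e') := f.map_restrict _ _
    have hs : X.sign (f.map 1 e) (f.map 1 e') = X.sign e e' := by
      classical
      unfold sign
      rw [← hr]
      exact congrArg₂ (fun s t : ℤ => s - t) (if_congr f.parallel_map_iff rfl rfl)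
        (if_congr f.parallel_map_iff rfl rfl)
    simp [f.chainMap_single, dualCochain, hs]
  exact LinearMap.congr_fun this z

theorem Auto.dualCochain_of_onH1 {f : X.Auto} (hf : f.onH1 = LinearMap.id) (e : X.Cube 1)
    {z : X.Cube 1 →₀ ℤ} (hz : z ∈ LinearMap.ker X.boundary) :
    X.dualCochain e (f.chainMap z) = X.dualCochain e z := by
  have h := congrArg (X.intersection e)
    (LinearMap.congr_fun hf (Submodule.Quotient.mk ⟨z, hz⟩))
  exact h

end CubeComplex

variable {V : Type u} {Γ : SimpleGraph V} {k : ℕ} {p : Fin k → WhiteheadPartition Γ}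

theorem WhiteheadPartition.IsCompatibleCollection.loopNumber_map (hp : IsCompatibleCollection p)
    {f : (blowup p).Auto} (hf : f.onH1 = LinearMap.id) (e : (blowup p).Cube 1) (v : V) :
    loopNumber p v (edgeLabel (f.map 1 e)) = loopNumber p v (edgeLabel e) := by
  obtain ⟨R, hR⟩ := hp.exists_regionLits (v, false)
  obtain ⟨z, hz, -, h⟩ := hp.exists_loop hR
  rw [← h, ← h, ← CubeComplex.Auto.dualCochain_of_onH1 hf _ hz, f.dualCochain_chainMap]

/-! ### Homologous hyperplanes -/

theorem loopNumber_not (v : V) (l : V ⊕ Fin k) (b : Bool) :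
    loopNumber p v (l, !b) = -loopNumber p v (l, b) := by
  cases l with
  | inl w => cases b <;> simp [loopNumber, apply_ite Neg.neg]
  | inr i =>
    classical
    have e₁ : ((v, true) ∈ (p i).side (!b) ∧ (v, false) ∈ (p i).side (!!b)) ↔
        ((v, false) ∈ (p i).side b ∧ (v, true) ∈ (p i).side (!b)) := by rw [Bool.not_not, and_comm]
    have e₂ : ((v, false) ∈ (p i).side (!b) ∧ (v, true) ∈ (p i).side (!!b)) ↔
        ((v, true) ∈ (p i).side b ∧ (v, false) ∈ (p i).side (!b)) := by rw [Bool.not_not, and_comm]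
    exact (congrArg₂ (fun s t : ℤ => s - t) (if_congr e₁ rfl rfl) (if_congr e₂ rfl rfl)).trans
      (neg_sub _ _).symm

theorem loopNumber_eq_one {v : V} {i : Fin k} {b : Bool} :
    loopNumber p v (Sum.inr i, b) = 1 ↔
      (v, true) ∈ (p i).side b ∧ (v, false) ∈ (p i).side (!b) := by
  classical
  have h : ¬ (((v, true) ∈ (p i).side b ∧ (v, false) ∈ (p i).side (!b)) ∧
      (v, false) ∈ (p i).side b ∧ (v, true) ∈ (p i).side (!b)) :=
    fun h => notMem_side h.1.1 h.2.2
  simp only [loopNumber]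
  split_ifs with h1 h2 h2 <;> simp_all

theorem loopNumber_eq_neg_one {v : V} {i : Fin k} {b : Bool} :
    loopNumber p v (Sum.inr i, b) = -1 ↔
      (v, false) ∈ (p i).side b ∧ (v, true) ∈ (p i).side (!b) := by
  have h := loopNumber_eq_one (p := p) (v := v) (i := i) (b := !b)
  rw [loopNumber_not, Bool.not_not] at h
  rw [← neg_inj, neg_neg, h, and_comm]

/-- The intersection numbers of a partition determine its singles. -/
theorem single_iff_of_loopNumber_eq {i j : Fin k} {a b : Bool}
    (h : ∀ v, loopNumber p v (Sum.inr i, a) = loopNumber p v (Sum.inr j, b)) (x : V × Bool) :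
    (x ∈ (p i).side a ∧ litInv x ∈ (p i).side (!a)) ↔
      (x ∈ (p j).side b ∧ litInv x ∈ (p j).side (!b)) := by
  obtain ⟨v, c⟩ := x
  cases c
  · change _ ∧ (v, true) ∈ _ ↔ _ ∧ (v, true) ∈ _
    rw [← loopNumber_eq_neg_one, ← loopNumber_eq_neg_one, h]
  · change _ ∧ (v, false) ∈ _ ↔ _ ∧ (v, false) ∈ _
    rw [← loopNumber_eq_one, ← loopNumber_eq_one, h]

theorem sideBase_single_of_loopNumber_eq {i j : Fin k} {a b : Bool}
    (h : ∀ v, loopNumber p v (Sum.inr i, a) = loopNumber p v (Sum.inr j, b)) :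
    (p i).sideBase a ∈ (p j).side b ∧ (p i).sideBase (!a) ∈ (p j).side (!b) := by
  have := (single_iff_of_loopNumber_eq h ((p i).sideBase a)).1
    ⟨(p i).sideBase_mem a, by rw [litInv_sideBase]; exact (p i).sideBase_mem _⟩
  rwa [litInv_sideBase] at this

theorem not_commute_of_loopNumber_eq {i j : Fin k} {a b : Bool}
    (h : ∀ v, loopNumber p v (Sum.inr i, a) = loopNumber p v (Sum.inr j, b)) :
    ¬ (p i).Commute (p j) := fun hc =>
  notMem_link (sideBase_single_of_loopNumber_eq h).1 (SimpleGraph.Adj.symm (commute_iff.1 hc))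

theorem link_eq_of_loopNumber_eq {i j : Fin k} {a b : Bool}
    (h : ∀ v, loopNumber p v (Sum.inr i, a) = loopNumber p v (Sum.inr j, b)) :
    (p i).link = (p j).link := by
  have h1 := sideBase_single_of_loopNumber_eq h
  have h2 := sideBase_single_of_loopNumber_eq fun v => (h v).symm
  rw [← litInv_sideBase] at h1 h2
  exact link_eq_of_dominated (not_commute_of_loopNumber_eq h)
    (dominated_of_sideBase_single h1.1 h1.2) (dominated_of_sideBase_single h2.1 h2.2)

/-- Homologous partitions are nested. -/
theorem WhiteheadPartition.IsCompatibleCollection.disj_of_loopNumber_eq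
    (hp : IsCompatibleCollection p) {i j : Fin k} {a b : Bool} (hij : i ≠ j)
    (h : ∀ v, loopNumber p v (Sum.inr i, a) = loopNumber p v (Sum.inr j, b)) :
    (p i).Disj a (p j) (!b) ∨ (p i).Disj (!a) (p j) b := by
  obtain ⟨a', b', hd⟩ := hp.exists_disj hij (not_commute_of_loopNumber_eq h)
  obtain ⟨h1, h2⟩ := sideBase_single_of_loopNumber_eq h
  by_cases ha : a' = a <;> by_cases hb : b' = b
  · subst ha; subst hb
    exact absurd h1 (hd.notMem ((p i).sideBase_mem _))
  · subst ha
    rw [Bool.eq_not.2 hb] at hd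
    exact Or.inl hd
  · subst hb
    rw [Bool.eq_not.2 ha] at hd
    exact Or.inr hd
  · rw [Bool.eq_not.2 ha, Bool.eq_not.2 hb] at hd
    exact absurd h2 (hd.notMem ((p i).sideBase_mem _))

theorem eq_of_loopNumber_eq_inr {i : Fin k} {a b : Bool}
    (h : ∀ v, loopNumber p v (Sum.inr i, a) = loopNumber p v (Sum.inr i, b)) : a = b := by
  by_contra hne
  have h1 := h (p i).base.1
  rw [Bool.eq_not.2 hne, loopNumber_not] at h1
  have h2 := loopNumber_base (p := p) i b
  omega

theorem eq_of_loopNumber_eq_inl {v w : V} {a b : Bool}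
    (h : ∀ u, loopNumber p u (Sum.inl v, a) = loopNumber p u (Sum.inl w, b)) :
    ((Sum.inl v, a) : (V ⊕ Fin k) × Bool) = (Sum.inl w, b) := by
  have h1 := h v
  by_cases hw : w = v
  · subst hw
    revert h1
    cases a <;> cases b <;> simp [loopNumber]
  · rw [loopNumber_of_ne hw] at h1
    exact absurd h1 (loopNumber_self v a)

/-! ### The level of a region with respect to a homology class of hyperplanes -/

section Level

variable [Fintype V]

open Classical in
variable (p) in
/-- The oriented labels of the hyperplanes that have the same intersection numbers as the one with
label `l`. -/
noncomputable def homologyClass (l : (V ⊕ Fin k) × Bool) : Finset ((V ⊕ Fin k) × Bool) :=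
  Finset.univ.filter fun l' => ∀ v, loopNumber p v l' = loopNumber p v l

theorem mem_homologyClass {l l' : (V ⊕ Fin k) × Bool} :
    l' ∈ homologyClass p l ↔ ∀ v, loopNumber p v l' = loopNumber p v l := by
  simp [homologyClass]

theorem self_mem_homologyClass (l : (V ⊕ Fin k) × Bool) : l ∈ homologyClass p l :=
  mem_homologyClass.2 fun _ => rfl

theorem loopNumber_eq_of_mem {l l₁ l₂ : (V ⊕ Fin k) × Bool} (h₁ : l₁ ∈ homologyClass p l)
    (h₂ : l₂ ∈ homologyClass p l) (v : V) : loopNumber p v l₁ = loopNumber p v l₂ :=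
  (mem_homologyClass.1 h₁ v).trans (mem_homologyClass.1 h₂ v).symm

/-- The number of partitions in the homology class of `l` on whose initial side the region lies. -/
noncomputable def level (l : (V ⊕ Fin k) × Bool) (R : Region p) : ℤ :=
  ∑ l' ∈ homologyClass p l, sideIndicator R l'

theorem sum_crossing (l : (V ⊕ Fin k) × Bool) (R S : Region p) :
    ∑ l' ∈ homologyClass p l, crossing R S l' = level l R - level l S := by
  simp only [crossing, Finset.sum_sub_distrib, level]

theorem level_le (l : (V ⊕ Fin k) × Bool) (R : Region p) :
    level l R ≤ (homologyClass p l).card := by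
  refine (Finset.sum_le_sum fun l' _ => sideIndicator_le_one R l').trans ?_
  simp

theorem level_lt {l l' : (V ⊕ Fin k) × Bool} {R : Region p} (h : l' ∈ homologyClass p l)
    (h' : sideIndicator R l' = 0) : level l R < (homologyClass p l).card := by
  have : level l R < ∑ _l' ∈ homologyClass p l, (1 : ℤ) :=
    Finset.sum_lt_sum (fun l' _ => sideIndicator_le_one R l') ⟨l', h, by rw [h']; exact one_pos⟩
  simpa using this

theorem level_pos {l l' : (V ⊕ Fin k) × Bool} {R : Region p} (h : l' ∈ homologyClass p l)
    (h' : sideIndicator R l' = 1) : 0 < level l R :=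
  Finset.sum_pos' (fun l' _ => sideIndicator_nonneg R l') ⟨l', h, by rw [h']; exact one_pos⟩

/-- The level of the initial region of an edge exceeds that of its terminal region by the
intersection number of the edge with the homology class, modulo the size of the class.  Indeed, a
generator `v` meets all hyperplanes of the class equally often, once its edge is closed up by a path
along edges labelled by partitions. -/
theorem dvd_sum_labelSign_sub {R S : Region p} {l₀ l : (V ⊕ Fin k) × Bool}
    (h : IsBlowupEdge p R S l) : ((homologyClass p l₀).card : ℤ) ∣
      ∑ l' ∈ homologyClass p l₀, labelSign l' l - (level l₀ R - level l₀ S) := by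
  have gen : ∀ {R S : Region p} {v : V}, IsBlowupEdge p R S (Sum.inl v, false) →
      ((homologyClass p l₀).card : ℤ) ∣
        ∑ l' ∈ homologyClass p l₀, labelSign l' (Sum.inl v, false) -
          (level l₀ R - level l₀ S) := by
    intro R S v h
    rw [← neg_sub (level l₀ S), sub_neg_eq_add, ← sum_crossing, ← Finset.sum_add_distrib]
    refine ⟨loopNumber p v l₀, ?_⟩
    rw [Finset.sum_congr rfl fun l' hl' =>
      (labelSign_add_crossing h l').trans (mem_homologyClass.1 hl' v)]
    simp
  obtain ⟨v | i, b⟩ := l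
  · cases b
    · exact gen h
    · obtain ⟨c, hc⟩ := gen h.reverse
      refine ⟨-c, ?_⟩
      rw [mul_neg, ← hc,
        Finset.sum_congr rfl fun l' _ => show labelSign l' (Sum.inl v, true) =
          -labelSign l' (Sum.inl v, false) from (neg_sub _ _).symm, Finset.sum_neg_distrib]
      ring
  · rw [← sum_crossing, ← Finset.sum_sub_distrib]
    simp [labelSign_eq_crossing h]

/-- Edges with different labels in one homology class start at levels that differ modulo the size of
the class. -/
theorem WhiteheadPartition.IsCompatibleCollection.not_dvd_level_sub (hp : IsCompatibleCollection p)
    {R S R' S' : Region p} {l₀ l l' : (V ⊕ Fin k) × Bool} (hl : l ∈ homologyClass p l₀)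
    (hl' : l' ∈ homologyClass p l₀) (hne : l ≠ l') (h : IsBlowupEdge p R S l)
    (h' : IsBlowupEdge p R' S' l') :
    ¬ ((homologyClass p l₀).card : ℤ) ∣ level l₀ R - level l₀ R' := by
  have small : ∀ {x y : ℤ}, 0 < y → y < x → x ≤ (homologyClass p l₀).card →
      ¬ ((homologyClass p l₀).card : ℤ) ∣ x - y := by
    intro x y h1 h2 h3 hd
    have := Int.le_of_dvd (by omega) hd
    omega
  -- if `P_i < P_j`, then every side of the class that contains `R'` also contains `R`
  have nested : ∀ {R S R' S' : Region p} {i j : Fin k} {a b : Bool},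
      (Sum.inr i, a) ∈ homologyClass p l₀ → (Sum.inr j, b) ∈ homologyClass p l₀ →
      IsBlowupEdge p R S (Sum.inr i, a) → IsBlowupEdge p R' S' (Sum.inr j, b) → i ≠ j →
      (p i).Disj a (p j) (!b) → ¬ ((homologyClass p l₀).card : ℤ) ∣ level l₀ R - level l₀ R' := by
    intro R S R' S' i j a b hi hj hR hR' hij hd
    have hRj : R.1 j = b := by
      by_contra hne
      exact R.not_disj i j (by rw [hR.1, Bool.eq_not.2 hne]; exact hd)
    have hS'j : S'.1 j = !b := by rw [eq_not_of_flip hR'.2, hR'.1]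
    have hR'i : R'.1 i = !a := by
      rw [Bool.eq_not, ← eq_of_flip hR'.2 hij]
      intro h
      exact S'.not_disj i j (by rw [h, hS'j]; exact hd)
    refine small (level_pos hj (by simp [sideIndicator, hR'.1])) ?_ (level_le _ _)
    refine Finset.sum_lt_sum (fun l hl => ?_) ⟨_, hi, by simp [sideIndicator, hR.1, hR'i]⟩
    obtain ⟨v | m, d⟩ := l
    · exact le_rfl
    by_cases hd' : R'.1 m = d
    · have : R.1 m = d := by
        by_cases hmj : m = j
        · subst hmj
          rw [hRj, ← hd', hR'.1]
        by_cases hmi : m = i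
        · subst hmi
          rw [hR.1]
          exact eq_of_loopNumber_eq_inr (loopNumber_eq_of_mem hi hl)
        rcases hp.disj_of_loopNumber_eq (Ne.symm hmj) (loopNumber_eq_of_mem hj hl) with hn | hn
        · by_contra hne
          exact R.not_disj j m (by rw [hRj, Bool.eq_not.2 hne]; exact hn)
        · exact absurd hn (by
            rw [← hS'j, ← hd', ← eq_of_flip hR'.2 hmj]
            exact S'.not_disj j m)
      simp [sideIndicator, hd', this]
    · simp only [sideIndicator, hd', if_false]
      split_ifs <;> simp
  -- edges labelled by a generator in the class start at level zero
  have mixed : ∀ {R S R' S' : Region p} {v : V} {j : Fin k} {c b : Bool},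
      (Sum.inl v, c) ∈ homologyClass p l₀ → (Sum.inr j, b) ∈ homologyClass p l₀ →
      IsBlowupEdge p R S (Sum.inl v, c) → IsBlowupEdge p R' S' (Sum.inr j, b) →
      ¬ ((homologyClass p l₀).card : ℤ) ∣ level l₀ R' - level l₀ R := by
    intro R S R' S' v j c b hv hj hR hR' hd
    have h0 : level l₀ R = 0 := by
      refine Finset.sum_eq_zero fun l hl => ?_
      obtain ⟨w | m, d⟩ := l
      · rfl
      have hmem : (v, c) ∈ (p m).side (!d) := by
        have h1 := loopNumber_eq_of_mem hl hv v
        cases c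
        · exact (loopNumber_eq_one.1 (h1.trans (by simp [loopNumber]))).2
        · exact (loopNumber_eq_neg_one.1 (h1.trans (by simp [loopNumber]))).2
      simp [sideIndicator, eq_of_mem_regionLits hR.1 hmem]
    rw [h0, sub_zero] at hd
    have h1 := level_pos (R := R') hj (by simp [sideIndicator, hR'.1])
    have h2 := level_lt (R := R') hv rfl
    have := Int.le_of_dvd h1 hd
    omega
  obtain ⟨v | i, a⟩ := l <;> obtain ⟨w | j, b⟩ := l'
  · exact absurd (eq_of_loopNumber_eq_inl (loopNumber_eq_of_mem hl hl')) hne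
  · rw [← dvd_neg, neg_sub]
    exact mixed hl hl' h h'
  · exact mixed hl' hl h' h
  · have hij : i ≠ j := by
      rintro rfl
      exact hne (by rw [eq_of_loopNumber_eq_inr (loopNumber_eq_of_mem hl hl')])
    rcases hp.disj_of_loopNumber_eq hij (loopNumber_eq_of_mem hl hl') with hd | hd
    · exact nested hl hl' h h' hij hd
    · rw [← dvd_neg, neg_sub]
      exact nested hl' hl h' h hij.symm hd.symm

/-- Two different hyperplanes in a homology class bound a generator that is not a single of, and not
in the link of, the partitions in the class. -/
theorem WhiteheadPartition.IsCompatibleCollection.exists_generator_between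
    (hp : IsCompatibleCollection p) {l₀ l l' : (V ⊕ Fin k) × Bool} (hl : l ∈ homologyClass p l₀)
    (hl' : l' ∈ homologyClass p l₀) (hne : l ≠ l') :
    ∃ (w : V) (i : Fin k) (a : Bool), (Sum.inr i, a) ∈ homologyClass p l₀ ∧
      (w, false) ∉ (p i).link ∧ loopNumber p w l₀ = 0 := by
  have mixed : ∀ {v : V} {j : Fin k} {c b : Bool}, (Sum.inl v, c) ∈ homologyClass p l₀ →
      (Sum.inr j, b) ∈ homologyClass p l₀ → ∃ (w : V) (i : Fin k) (a : Bool),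
        (Sum.inr i, a) ∈ homologyClass p l₀ ∧ (w, false) ∉ (p i).link ∧
          loopNumber p w l₀ = 0 := by
    intro v j c b hv hj
    obtain ⟨w, hw, hwne⟩ := exists_ne_sideBase (p j) b
    have hbase : v = (p j).base.1 := by
      by_contra hne
      refine loopNumber_base (p := p) j b ?_
      rw [loopNumber_eq_of_mem hj hv, loopNumber_of_ne hne]
    refine ⟨w.1, j, b, hj, notMem_link (x := w) hw, ?_⟩
    rw [← mem_homologyClass.1 hv, loopNumber_of_ne]
    rw [hbase]
    exact hwne.symm
  have nested : ∀ {i j : Fin k} {a b : Bool}, (Sum.inr i, a) ∈ homologyClass p l₀ →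
      (Sum.inr j, b) ∈ homologyClass p l₀ → ∀ w ∈ (p i).side a, w ∉ (p j).side b →
      ∃ (w : V) (i : Fin k) (a : Bool),
        (Sum.inr i, a) ∈ homologyClass p l₀ ∧ (w, false) ∉ (p i).link ∧
          loopNumber p w l₀ = 0 := by
    intro i j a b hi hj w hw hw'
    refine ⟨w.1, i, a, hi, notMem_link (x := w) hw, ?_⟩
    have hwj : w ∈ (p j).side (!b) :=
      mem_side_not.2 ⟨hw', link_eq_of_loopNumber_eq (loopNumber_eq_of_mem hi hj) ▸ notMem_link hw⟩
    rw [← mem_homologyClass.1 hi, loopNumber_inr_eq_zero]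
    have hsingle := single_iff_of_loopNumber_eq (loopNumber_eq_of_mem hi hj) w
    have hinv : litInv w ∈ (p i).side a := by
      refine ((p i).mem_side_or a (litInv_notMem_link hw)).resolve_right fun h => ?_
      exact hw' (hsingle.1 ⟨hw, h⟩).1
    intro c d hd
    have hc : (w.1, c) = w ∨ (w.1, c) = litInv w := by
      by_cases hc : c = w.2
      · exact Or.inl (Prod.ext rfl hc)
      · exact Or.inr (Prod.ext rfl (Bool.eq_not.2 hc))
    rcases hc with hc | hc <;> rw [hc] at hd ⊢
    · rwa [eq_of_mem_side hd hw]
    · rw [litInv_litInv]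
      rwa [eq_of_mem_side hd hinv]
  obtain ⟨v | i, a⟩ := l <;> obtain ⟨w | j, b⟩ := l'
  · exact absurd (eq_of_loopNumber_eq_inl (loopNumber_eq_of_mem hl hl')) hne
  · exact mixed hl hl'
  · exact mixed hl' hl
  · have hij : i ≠ j := by
      rintro rfl
      exact hne (by rw [eq_of_loopNumber_eq_inr (loopNumber_eq_of_mem hl hl')])
    have hs := hp.side_ne hij (link_eq_of_loopNumber_eq (loopNumber_eq_of_mem hl hl')) a b
    by_cases hsub : (p i).side a ⊆ (p j).side b
    · obtain ⟨w, hw, hw'⟩ := Set.not_subset.1 fun h => hs (Set.Subset.antisymm hsub h)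
      exact nested hl' hl w hw hw'
    · obtain ⟨w, hw, hw'⟩ := Set.not_subset.1 hsub
      exact nested hl hl' w hw hw'

/-- An automorphism that acts trivially on homology shifts all levels by a constant. -/
theorem WhiteheadPartition.IsCompatibleCollection.dvd_level_autoRegion
    (hp : IsCompatibleCollection p) {f : (blowup p).Auto} (hf : f.onH1 = LinearMap.id)
    (l₀ : (V ⊕ Fin k) × Bool) (R R' : Region p) : ((homologyClass p l₀).card : ℤ) ∣
      (level l₀ (autoRegion f R) - level l₀ R) - (level l₀ (autoRegion f R') - level l₀ R') := by
  classical
  refine hp.induction_toward R' (motive := fun R => ((homologyClass p l₀).card : ℤ) ∣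
      (level l₀ (autoRegion f R) - level l₀ R) - (level l₀ (autoRegion f R') - level l₀ R'))
    (by simp) ?_ R
  intro R S i _ hS ih
  obtain ⟨e, rfl, rfl, he⟩ := exists_edge (isBlowupEdge_of_flip hS)
  have h1 := dvd_sum_labelSign_sub (l₀ := l₀) (isBlowupEdge_edge e)
  have h2 := dvd_sum_labelSign_sub (l₀ := l₀) (isBlowupEdge_edge (f.map 1 e))
  rw [edgeSource_map, edgeTarget_map] at h2
  have hsum : ∑ l' ∈ homologyClass p l₀, labelSign l' (edgeLabel (f.map 1 e)) =
      ∑ l' ∈ homologyClass p l₀, labelSign l' (edgeLabel e) := by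
    have hmem : ∀ e : (blowup p).Cube 1,
        edgeLabel (f.map 1 e) ∈ homologyClass p l₀ ↔ edgeLabel e ∈ homologyClass p l₀ := by
      intro e
      simp only [mem_homologyClass, hp.loopNumber_map hf]
    have hrev := hmem ((blowup p).rev e)
    rw [map_rev, edgeLabel_rev, edgeLabel_rev] at hrev
    simp only [labelSign, Finset.sum_sub_distrib, Finset.sum_ite_eq', hmem, hrev]
  rw [hsum] at h2
  obtain ⟨c, hc⟩ := dvd_add (dvd_sub h1 h2) ih
  exact ⟨c, by rw [← hc]; ring⟩

/-- An automorphism that acts trivially on homology preserves oriented labels.  If it shifts the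
levels of the homology class of a label by zero, then it preserves the labels in the class, as they
are determined by levels.  Otherwise, if the class has more than one element, it moves a loop that
stays in one level off the only level in which the hyperplane of a generator `w` lies, although the
loop has intersection number one with this hyperplane. -/
theorem WhiteheadPartition.IsCompatibleCollection.edgeLabel_map
    (hp : IsCompatibleCollection p) {f : (blowup p).Auto} (hf : f.onH1 = LinearMap.id)
    (e₀ : (blowup p).Cube 1) : edgeLabel (f.map 1 e₀) = edgeLabel e₀ := by
  classical
  by_contra hne
  have hl : edgeLabel (f.map 1 e₀) ∈ homologyClass p (edgeLabel e₀) :=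
    mem_homologyClass.2 (hp.loopNumber_map hf e₀)
  have hl₀ := self_mem_homologyClass (p := p) (edgeLabel e₀)
  have hshift := hp.not_dvd_level_sub hl hl₀ hne (isBlowupEdge_edge _) (isBlowupEdge_edge _)
  rw [edgeSource_map] at hshift
  generalize edgeLabel e₀ = l₀ at *
  have hshift' : ∀ R : Region p,
      ¬ ((homologyClass p l₀).card : ℤ) ∣ level l₀ (autoRegion f R) - level l₀ R := by
    intro R hd
    refine hshift ?_
    have := dvd_add (hp.dvd_level_autoRegion hf l₀ (edgeSource e₀) R) hd
    rwa [sub_add_cancel] at this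
  obtain ⟨w, i, a, hi, hwi, hw⟩ := hp.exists_generator_between hl hl₀ hne
  have hside : ∀ j b, (Sum.inr j, b) ∈ homologyClass p l₀ → ∃ d, ∀ c, (w, c) ∈ (p j).side d := by
    intro j b hj
    have hwj : (w, false) ∉ (p j).link := by
      rwa [← link_eq_of_loopNumber_eq (loopNumber_eq_of_mem hi hj)]
    obtain ⟨d, hd⟩ := exists_mem_side hwj
    refine ⟨d, fun c => ?_⟩
    cases c
    · exact hd
    · exact loopNumber_inr_eq_zero.1 ((mem_homologyClass.1 hj w).trans hw) _ _ hd
  have hlevel : ∀ {R S : Region p}, (∀ j b, (Sum.inr j, b) ∈ homologyClass p l₀ → R.1 j = S.1 j) →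
      level l₀ R = level l₀ S := by
    intro R S h
    refine Finset.sum_congr rfl fun l hl => ?_
    obtain ⟨v | j, b⟩ := l
    · rfl
    · simp only [sideIndicator, h j b hl]
  obtain ⟨R, hR⟩ := hp.exists_regionLits (w, false)
  have hlits : ∀ (S : Region p) c, (w, c) ∈ regionLits p S → level l₀ S = level l₀ R := by
    intro S c hS
    refine hlevel fun j b hj => ?_
    obtain ⟨d, hd⟩ := hside j b hj
    rw [eq_of_mem_regionLits hS (hd c), eq_of_mem_regionLits hR (hd false)]
  obtain ⟨z, hz, hsupp, hnum⟩ := hp.exists_loop hR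
  obtain ⟨e, he⟩ := hp.exists_edgeLabel (p := p) (Sum.inl w, false)
  have h1 : (blowup p).dualCochain e (f.chainMap z) ≠ 0 := by
    rw [CubeComplex.Auto.dualCochain_of_onH1 hf e hz, hnum, he]
    exact loopNumber_self w false
  refine h1 ?_
  have hz' : f.chainMap z = z.sum fun e' n => Finsupp.single (f.map 1 e') n := rfl
  rw [hz', map_finsuppSum]
  refine Finset.sum_eq_zero fun e' he' => ?_
  have hs : (blowup p).sign e (f.map 1 e') = 0 := by
    have hlab : ∀ c, edgeLabel (f.map 1 e') ≠ (Sum.inl w, c) := by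
      intro c hc
      have h2 := isBlowupEdge_edge (f.map 1 e')
      rw [hc, edgeSource_map] at h2
      refine hshift' (edgeSource e') ?_
      rw [hlits _ c h2.1]
      have h3 : level l₀ (edgeSource e') = level l₀ R := by
        refine hlevel fun j b hj => hsupp e' he' j fun b' hb' => ?_
        obtain ⟨d, hd⟩ := hside j b hj
        rw [eq_of_mem_side hb' (hd false)]
        exact hd true
      rw [h3, sub_self]
      exact dvd_zero _
    have h4 := hlab false
    have h5 := hlab true
    rw [hp.sign_eq, he]
    generalize edgeLabel (f.map 1 e') = l at *
    obtain ⟨l, c⟩ := l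
    cases c <;> simp_all [labelSign, eq_comm]
  simp [CubeComplex.dualCochain, hs]

end Level

end Criterion

theorem mainTheorem5 {V : Type*} [Finite V] (Γ : SimpleGraph V) {k : ℕ}
    (p : Fin k → WhiteheadPartition Γ) (hp : WhiteheadPartition.IsCompatibleCollection p) :
    ((blowup p).IsCompact ∧ (blowup p).IsSpecial) ∧
    ((blowup p).CrossingCondition ∧ (blowup p).SeparatingPairCondition ∧
      (blowup p).HyperplaneRigidity) ∧
    ∀ f : (blowup p).Auto, f ≠ CubeComplex.Auto.id (blowup p) → f.onH1 ≠ LinearMap.id := by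
  have := Fintype.ofFinite V
  exact ⟨⟨isCompact_blowup, isSpecial_blowup⟩,
    ⟨hp.crossingCondition, hp.separatingPairCondition, hp.hyperplaneRigidity⟩,
    fun f hne hf => hne (hp.eq_id_of_edgeLabel f (hp.edgeLabel_map hf))⟩
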